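/- Let $\kappa\in\{-1,0,1\}$, let $f:\mathbb R\to\mathbb R$ be smooth, and let $\mathbb R\times_f\mathbb M^2(\kappa)$ be $\mathbb R\times\mathbb M^2(\kappa)$ with the metric $\langle\cdot,\cdot\rangle=dt^2+e^{2f(t)}d\sigma_\kappa^2$, where $(\mathbb M^2(\kappa),d\sigma^2_\kappa)$ is the complete simply connected surface of constant Gaussian curvature $\kappa$. Let $\varphi:\Sigma\to\mathbb R\times_f\mathbb M^2(\kappa)$ be an isometric immersion of a surface $\Sigma$ with a smooth unit normal field $N$ and with positive extrinsic curvature $K_e$ (the determinant of the shape operator); completeness of $\Sigma$ is not needed. Let $z$ be a local parameter of $\Sigma$ that is conformal for the second fundamental form, and write $$I=E\,dz^2+2F|dz|^2+\overline E\,d\overline z^2,\qquad II=-\langle d\varphi,dN\rangle=2\rho|dz|^2,\qquad D=|E|^2-F^2,$$ with $F,\rho$ real. Let $h$ be the height function of $\Sigma$ (the $\mathbb R$-component of $\varphi$), $\nu=\langle\partial_t,N\rangle$ the angle function, $\alpha=\overline E h_z-Fh_{\overline z}$, and let $\Gamma^k_{ij}$ be the Christoffel symbols of the Levi-Civita connection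 of $I$ in the frame $\partial_1=\partial_z$, $\partial_2=\partial_{\overline z}$, so that $\nabla_{\partial_i}\partial_j=\sum_k\Gamma^k_{ij}\partial_k$. Subscripts $z,\overline z$ denote the derivatives $\partial_z=\frac12(\partial_x-i\partial_y)$ and $\partial_{\overline z}=\frac12(\partial_x+i\partial_y)$, $z=x+iy$, and $f,f',f''$ are evaluated at $t=h$. Then on the domain of $z$: $$\frac{\rho_{\overline z}}{\rho}+(\Gamma^1_{12}-\Gamma^2_{22})=\frac{\nu}{\rho}\,\alpha\,(f''+\kappa e^{-2f}),$$ $$\nu_z=\frac{\overline\alpha K_e}{\rho}-f'\nu h_z,$$ $$\Gamma^1_{12}=-\frac{(K_e)_{\overline z}}{4K_e}+\frac{\nu\alpha}{2\rho}(f''+\kappa e^{-2f}),$$ $$h_{zz}=\Gamma^1_{11}h_z+\Gamma^2_{11}h_{\overline z}+f'E-f'(h_z)^2,$$ $$h_{z\overline z}=\rho\nu\Big(1-\frac{(f''+\kappa e^{-2f})(1-\nu^2)}{2K_e}\Big)-\frac1{4K_e}\big((K_e)_{\overline z}h_z+(K_e)_zh_{\overline z}\big)+f'(F-h_{\overline z}h_z),$$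 $$\alpha_z=\alpha\frac{D_z}{2D}+\frac1{4K_e}\big(\overline\alpha(K_e)_{\overline z}-\alpha(K_e)_z\big)-\rho F\nu-f'(\alpha h_z-D),$$ $$\nu_{z\overline z}=\frac1{4\rho}\big(\overline\alpha(K_e)_{\overline z}+\alpha(K_e)_z\big)-K_eF\nu-\frac{K_ef'}{\rho}(\alpha h_z-D)-f'\big(\nu_zh_{\overline z}+\nu h_{z\overline z}\big)-f''\nu|h_z|^2.$$ -/

import Mathlib

open scoped Manifold ContDiff ComplexConjugate

noncomputable section

namespace WarpedSurface

/-! ### The space forms and the warped product -/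

/-- `𝕄²(κ)` for `κ ∈ {-1, 0, 1}`, as the surface `κ (x² + y²) + w² = 1` in `ℝ³` (with `w > 0` when
`κ ≤ 0`): the hyperboloid model of the hyperbolic plane, the Euclidean plane `w = 1`, and the
unit sphere. -/
def spaceForm (κ : ℝ) : Set (Fin 3 → ℝ) :=
  {p | κ * (p 0 ^ 2 + p 1 ^ 2) + p 2 ^ 2 = 1 ∧ (κ ≤ 0 → 0 < p 2)}

/-- The symmetric form `dx² + dy² + κ dw²` on `ℝ³`. Its restriction to the tangent planes of
`𝕄²(κ)` is the Riemannian metric of `𝕄²(κ)`, of constant Gaussian curvature `κ`. -/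
def spaceFormMetric (κ : ℝ) (v w : Fin 3 → ℝ) : ℝ :=
  v 0 * w 0 + v 1 * w 1 + κ * (v 2 * w 2)

/-- The space `ℝ × ℝ³` that contains `ℝ × 𝕄²(κ)`; a point is `(t, p)`. -/
abbrev Ambient : Type := ℝ × (Fin 3 → ℝ)

/-- The underlying set of the warped product `ℝ ×_f 𝕄²(κ)`. -/
def warpedProduct (κ : ℝ) : Set Ambient := {x | x.2 ∈ spaceForm κ}

/-- The tangent space of `ℝ × 𝕄²(κ)` at the point `x`. -/
def ambientTangent (κ : ℝ) (x : Ambient) : Set Ambient :=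
  {V | κ * (x.2 0 * V.2 0 + x.2 1 * V.2 1) + x.2 2 * V.2 2 = 0}

/-- The warped metric `dt² + e^{2 f(t)} dσ_κ²` at the point `x`, on vectors tangent to
`ℝ × 𝕄²(κ)`. -/
def warpedMetric (κ : ℝ) (f : ℝ → ℝ) (x V W : Ambient) : ℝ :=
  V.1 * W.1 + Real.exp (2 * f x.1) * spaceFormMetric κ V.2 W.2

/-- The vertical unit field `ξ = ∂_t`. -/
def xi : Ambient := (1, 0)

/-- The Levi-Civita covariant derivative `∇̄_u V` at the parameter `w`, in the direction `u`, of a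
vector field `V` tangent to `ℝ ×_f 𝕄²(κ)` along a map `X = (h, p)` from the parameter plane to
`ℝ ×_f 𝕄²(κ)`. Write `V = (a, v)`. The Levi-Civita derivative of `𝕄²(κ)` is the tangential part
`∂_u v + κ ⟨∂_u p, v⟩ p` of the derivative in `ℝ³`, and for the warped product with warping function
`e^f` one gets
`∇̄_u V = (∂_u a - f' e^{2f} ⟨∂_u p, v⟩, ∂_u v + κ ⟨∂_u p, v⟩ p + f' (∂_u h • v + a • ∂_u p))`.
The three lemmas below (the derivative is tangent, compatible with the metric and symmetric)
say that this is the Levi-Civita connection. -/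
def covDeriv (κ : ℝ) (f : ℝ → ℝ) (X V : ℂ → Ambient) (w u : ℂ) : Ambient :=
  let dX := fderiv ℝ X w u
  let dV := fderiv ℝ V w u
  let b := spaceFormMetric κ dX.2 (V w).2
  (dV.1 - deriv f (X w).1 * Real.exp (2 * f (X w).1) * b,
    dV.2 + (κ * b) • (X w).2 + deriv f (X w).1 • (dX.1 • (V w).2 + (V w).1 • dX.2))

/-! ### Parametrized surfaces

`X` is a local parametrization of the surface by a parameter `z` in the complex plane, and `n` is the
unit normal field in that parameter. -/

/-- The first fundamental form `I(u, v) = ⟨dX(u), dX(v)⟩` at the parameter `w`. -/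
def firstForm (κ : ℝ) (f : ℝ → ℝ) (X : ℂ → Ambient) (w u v : ℂ) : ℝ :=
  warpedMetric κ f (X w) (fderiv ℝ X w u) (fderiv ℝ X w v)

/-- The second fundamental form `II(u, v) = -⟨dX(u), ∇̄_v n⟩` at the parameter `w`. -/
def secondForm (κ : ℝ) (f : ℝ → ℝ) (X n : ℂ → Ambient) (w u v : ℂ) : ℝ :=
  -warpedMetric κ f (X w) (fderiv ℝ X w u) (covDeriv κ f X n w v)

/-- The extrinsic curvature `K_e = det II / det I`, the determinant of the shape operator. -/
def extrinsicCurvature (κ : ℝ) (f : ℝ → ℝ) (X n : ℂ → Ambient) (w : ℂ) : ℝ :=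
  (secondForm κ f X n w 1 1 * secondForm κ f X n w Complex.I Complex.I
      - secondForm κ f X n w 1 Complex.I * secondForm κ f X n w Complex.I 1) /
    (firstForm κ f X w 1 1 * firstForm κ f X w Complex.I Complex.I
      - firstForm κ f X w 1 Complex.I * firstForm κ f X w Complex.I 1)

/-- The Wirtinger derivative `∂_z = (∂_x - i ∂_y) / 2`. -/
def dz (g : ℂ → ℂ) (w : ℂ) : ℂ :=
  (fderiv ℝ g w 1 - Complex.I * fderiv ℝ g w Complex.I) / 2

/-- The Wirtinger derivative `∂_z̄ = (∂_x + i ∂_y) / 2`. -/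
def dzbar (g : ℂ → ℂ) (w : ℂ) : ℂ :=
  (fderiv ℝ g w 1 + Complex.I * fderiv ℝ g w Complex.I) / 2

/-- The coefficient `E = I(∂_z, ∂_z)` in `I = E dz² + 2 F |dz|² + Ē dz̄²`. -/
def coeffE (κ : ℝ) (f : ℝ → ℝ) (X : ℂ → Ambient) (w : ℂ) : ℂ :=
  (((firstForm κ f X w 1 1 - firstForm κ f X w Complex.I Complex.I : ℝ) : ℂ)
    - 2 * Complex.I * ((firstForm κ f X w 1 Complex.I : ℝ) : ℂ)) / 4

/-- The coefficient `F = I(∂_z, ∂_z̄)`, a real function. -/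
def coeffF (κ : ℝ) (f : ℝ → ℝ) (X : ℂ → Ambient) (w : ℂ) : ℝ :=
  (firstForm κ f X w 1 1 + firstForm κ f X w Complex.I Complex.I) / 4

/-- `D = |E|² - F²`. -/
def coeffD (κ : ℝ) (f : ℝ → ℝ) (X : ℂ → Ambient) (w : ℂ) : ℝ :=
  ‖coeffE κ f X w‖ ^ 2 - coeffF κ f X w ^ 2

/-- The matrix of the first fundamental form in the complex frame `∂_1 = ∂_z`, `∂_2 = ∂_z̄`. -/
def metricMatrix (κ : ℝ) (f : ℝ → ℝ) (X : ℂ → Ambient) (w : ℂ) : Matrix (Fin 2) (Fin 2) ℂ :=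
  !![coeffE κ f X w, (coeffF κ f X w : ℂ);
    (coeffF κ f X w : ℂ), conj (coeffE κ f X w)]

/-- The derivatives along the complex frame: index `0` is `∂_1 = ∂_z`, index `1` is
`∂_2 = ∂_z̄`. -/
def frameDeriv (i : Fin 2) (g : ℂ → ℂ) (w : ℂ) : ℂ :=
  if i = 0 then dz g w else dzbar g w

/-- The Christoffel symbols `Γ^k_{ij} = ½ ∑_l g^{kl} (∂_i g_{jl} + ∂_j g_{il} - ∂_l g_{ij})` of the
Levi-Civita connection of the first fundamental form in the frame `∂_1 = ∂_z`, `∂_2 = ∂_z̄`, so that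
`∇_{∂_i} ∂_j = ∑_k Γ^k_{ij} ∂_k`. The indices `1`, `2` are written `0`, `1`. -/
def christoffel (κ : ℝ) (f : ℝ → ℝ) (X : ℂ → Ambient) (k i j : Fin 2) (w : ℂ) : ℂ :=
  (1 / 2) * ∑ l : Fin 2, (metricMatrix κ f X w)⁻¹ k l *
    (frameDeriv i (fun w' => metricMatrix κ f X w' j l) w
      + frameDeriv j (fun w' => metricMatrix κ f X w' i l) w
      - frameDeriv l (fun w' => metricMatrix κ f X w' i j) w)

/-- The height function `h`, the `ℝ`-component of the surface. -/
def height (X : ℂ → Ambient) (w : ℂ) : ℝ := (X w).1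

/-- The angle function `ν = ⟨ξ, n⟩`. -/
def angle (κ : ℝ) (f : ℝ → ℝ) (X n : ℂ → Ambient) (w : ℂ) : ℝ :=
  warpedMetric κ f (X w) xi (n w)

/-- `α = Ē h_z - F h_z̄`. -/
def alpha (κ : ℝ) (f : ℝ → ℝ) (X : ℂ → Ambient) (w : ℂ) : ℂ :=
  conj (coeffE κ f X w) * dz (fun w' => (height X w' : ℂ)) w
    - (coeffF κ f X w : ℂ) * dzbar (fun w' => (height X w' : ℂ)) w

/-! ### Surfaces immersed in the warped product -/

section Surface

variable {S : Type*} [TopologicalSpace S] [ChartedSpace ℂ S]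

/-- `φ` is a smooth immersion of the surface `S` (a `2`-manifold, modelled on the real plane `ℂ`)
into `ℝ ×_f 𝕄²(κ)`; `S` carries the pulled-back metric. -/
structure IsSurfaceImmersion (κ : ℝ) (φ : S → Ambient) : Prop where
  mem : ∀ q, φ q ∈ warpedProduct κ
  smooth : ContMDiff 𝓘(ℝ, ℂ) 𝓘(ℝ, Ambient) ∞ φ
  injective : ∀ q, Function.Injective (mfderiv 𝓘(ℝ, ℂ) 𝓘(ℝ, Ambient) φ q)

/-- `N` is a smooth unit normal vector field along the immersion `φ`. -/
structure IsUnitNormal (κ : ℝ) (f : ℝ → ℝ) (φ N : S → Ambient) : Prop where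
  tangent : ∀ q, N q ∈ ambientTangent κ (φ q)
  smooth : ContMDiff 𝓘(ℝ, ℂ) 𝓘(ℝ, Ambient) ∞ N
  unit : ∀ q, warpedMetric κ f (φ q) (N q) (N q) = 1
  normal : ∀ q (v : TangentSpace 𝓘(ℝ, ℂ) q),
    warpedMetric κ f (φ q) (mfderiv 𝓘(ℝ, ℂ) 𝓘(ℝ, Ambient) φ q v) (N q) = 0

/-- The surface has positive extrinsic curvature (expressed in all local parameters). -/
def HasPosExtrinsicCurvature (κ : ℝ) (f : ℝ → ℝ) (φ N : S → Ambient) : Prop :=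
  ∀ c ∈ IsManifold.maximalAtlas 𝓘(ℝ, ℂ) ∞ S, ∀ w ∈ c.target,
    0 < extrinsicCurvature κ f (φ ∘ c.symm) (N ∘ c.symm) w

/-- The local parameter `z` of the surface is conformal for the second fundamental form, with
`II = 2 ρ |dz|²`. -/
def IsConformalForSecondForm (κ : ℝ) (f : ℝ → ℝ) (φ N : S → Ambient)
    (z : OpenPartialHomeomorph S ℂ) (ρ : ℂ → ℝ) : Prop :=
  z ∈ IsManifold.maximalAtlas 𝓘(ℝ, ℂ) ∞ S ∧
    ∀ w ∈ z.target, ∀ u : ℂ,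
      secondForm κ f (φ ∘ z.symm) (N ∘ z.symm) w u u = 2 * ρ w * ‖u‖ ^ 2

end Surface

/-! ### The connection is the Levi-Civita connection -/

theorem hasFDerivAt_components {V : ℂ → Ambient} {w : ℂ} (hV : DifferentiableAt ℝ V w) :
    HasFDerivAt (fun w' => (V w').1) ((ContinuousLinearMap.fst ℝ ℝ (Fin 3 → ℝ)).comp (fderiv ℝ V w)) w ∧
    ∀ i, HasFDerivAt (fun w' => (V w').2 i)
      (((ContinuousLinearMap.proj (R := ℝ) (φ := fun _ : Fin 3 => ℝ) i).comp
        (ContinuousLinearMap.snd ℝ ℝ (Fin 3 → ℝ))).comp (fderiv ℝ V w)) w := by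
  refine ⟨?_, fun i => ?_⟩
  · exact (ContinuousLinearMap.fst ℝ ℝ (Fin 3 → ℝ)).hasFDerivAt.comp w hV.hasFDerivAt
  · exact ((ContinuousLinearMap.proj (R := ℝ) (φ := fun _ : Fin 3 => ℝ) i).comp
        (ContinuousLinearMap.snd ℝ ℝ (Fin 3 → ℝ))).hasFDerivAt.comp w hV.hasFDerivAt

/-- The covariant derivative of a tangent field is tangent. -/
theorem covDeriv_mem_ambientTangent {κ : ℝ} (hκ : κ = -1 ∨ κ = 0 ∨ κ = 1) (f : ℝ → ℝ)
    {X V : ℂ → Ambient} {w : ℂ} (hX : DifferentiableAt ℝ X w) (hV : DifferentiableAt ℝ V w)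
    (hXm : ∀ᶠ w' in nhds w, X w' ∈ warpedProduct κ)
    (hVm : ∀ᶠ w' in nhds w, V w' ∈ ambientTangent κ (X w')) (u : ℂ) :
    covDeriv κ f X V w u ∈ ambientTangent κ (X w) := by
  obtain ⟨-, x⟩ := hasFDerivAt_components hX
  obtain ⟨-, v⟩ := hasFDerivAt_components hV
  have e1 := (((((x 0).mul (v 0)).add ((x 1).mul (v 1))).const_mul κ).add ((x 2).mul (v 2))).unique
    ((hasFDerivAt_const (0 : ℝ) w).congr_of_eventuallyEq hVm)
  have e2 := (((((x 0).mul (x 0)).add ((x 1).mul (x 1))).const_mul κ).add ((x 2).mul (x 2))).unique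
    ((hasFDerivAt_const (1 : ℝ) w).congr_of_eventuallyEq
      (hXm.mono fun w' h => by
        have := h.1
        simp only [pow_two] at this
        exact this))
  have e1 := congrArg (fun L : ℂ →L[ℝ] ℝ => L u) e1
  have e2 := congrArg (fun L : ℂ →L[ℝ] ℝ => L u) e2
  have h1 := hXm.self_of_nhds.1
  have h2 : _ = _ := hVm.self_of_nhds
  simp only [add_apply, smul_apply, smul_eq_mul,
    ContinuousLinearMap.comp_apply, ContinuousLinearMap.proj_apply,
    ContinuousLinearMap.coe_snd', zero_apply] at e1 e2
  simp only [covDeriv, ambientTangent, spaceFormMetric, Set.mem_ofPred_eq, Pi.add_apply,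
    Pi.smul_apply, smul_eq_mul]
  rcases hκ with rfl | rfl | rfl
  · linear_combination e1 + deriv f (X w).1 * (fderiv ℝ X w u).1 * h2
      + deriv f (X w).1 * (V w).1 / 2 * e2 + ((V w).2 0 * (fderiv ℝ X w u).2 0
        + (V w).2 1 * (fderiv ℝ X w u).2 1 - (V w).2 2 * (fderiv ℝ X w u).2 2) * (-h1)
  · linear_combination e1 + deriv f (X w).1 * (fderiv ℝ X w u).1 * h2
      + deriv f (X w).1 * (V w).1 / 2 * e2
      - (fderiv ℝ X w u).2 2 * ((X w).2 2 * h2 - (V w).2 2 * h1)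
  · linear_combination e1 + deriv f (X w).1 * (fderiv ℝ X w u).1 * h2
      + deriv f (X w).1 * (V w).1 / 2 * e2 + ((V w).2 0 * (fderiv ℝ X w u).2 0
        + (V w).2 1 * (fderiv ℝ X w u).2 1 + (V w).2 2 * (fderiv ℝ X w u).2 2) * h1

/-- The covariant derivative is compatible with the warped metric. -/
theorem covDeriv_compatible {κ : ℝ} (hκ : κ = -1 ∨ κ = 0 ∨ κ = 1) {f : ℝ → ℝ}
    {X V W : ℂ → Ambient} {w : ℂ} (hf : DifferentiableAt ℝ f (X w).1)
    (hX : DifferentiableAt ℝ X w) (hV : DifferentiableAt ℝ V w) (hW : DifferentiableAt ℝ W w)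
    (hVm : V w ∈ ambientTangent κ (X w)) (hWm : W w ∈ ambientTangent κ (X w)) (u : ℂ) :
    fderiv ℝ (fun w' => warpedMetric κ f (X w') (V w') (W w')) w u =
      warpedMetric κ f (X w) (covDeriv κ f X V w u) (W w)
        + warpedMetric κ f (X w) (V w) (covDeriv κ f X W w u) := by
  obtain ⟨x0, x⟩ := hasFDerivAt_components hX
  obtain ⟨v0, v⟩ := hasFDerivAt_components hV
  obtain ⟨y0, y⟩ := hasFDerivAt_components hW
  have e := ((v0.mul y0).add (((hf.hasDerivAt.comp_hasFDerivAt w x0).const_mul 2).exp.mul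
    ((((v 0).mul (y 0)).add ((v 1).mul (y 1))).add (((v 2).mul (y 2)).const_mul κ)))).fderiv
  have e := congrArg (fun L : ℂ →L[ℝ] ℝ => L u) e
  refine Eq.trans e ?_
  simp [covDeriv, ambientTangent, spaceFormMetric, warpedMetric] at hVm hWm ⊢
  rcases hκ with rfl | rfl | rfl
  · linear_combination (Real.exp (2 * f (X w).1)) *
      (-((fderiv ℝ X w u).2 0 * (V w).2 0 + (fderiv ℝ X w u).2 1 * (V w).2 1
          - (fderiv ℝ X w u).2 2 * (V w).2 2) * hWm
        - ((fderiv ℝ X w u).2 0 * (W w).2 0 + (fderiv ℝ X w u).2 1 * (W w).2 1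
          - (fderiv ℝ X w u).2 2 * (W w).2 2) * hVm)
  · ring
  · linear_combination (Real.exp (2 * f (X w).1)) *
      (-((fderiv ℝ X w u).2 0 * (V w).2 0 + (fderiv ℝ X w u).2 1 * (V w).2 1
          + (fderiv ℝ X w u).2 2 * (V w).2 2) * hWm
        - ((fderiv ℝ X w u).2 0 * (W w).2 0 + (fderiv ℝ X w u).2 1 * (W w).2 1
          + (fderiv ℝ X w u).2 2 * (W w).2 2) * hVm)

/-- The covariant derivative is symmetric (torsion-free). -/
theorem covDeriv_symm (κ : ℝ) (f : ℝ → ℝ) {X : ℂ → Ambient} {w : ℂ} (hX : ContDiffAt ℝ 2 X w)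
    (u v : ℂ) :
    covDeriv κ f X (fun w' => fderiv ℝ X w' v) w u =
      covDeriv κ f X (fun w' => fderiv ℝ X w' u) w v := by
  have hs := hX.isSymmSndFDerivAt (by simp) u v
  have hd : DifferentiableAt ℝ (fderiv ℝ X) w :=
    (hX.fderiv_right (m := 1) (by norm_num)).differentiableAt (by norm_num)
  have h1 : ∀ a b : ℂ, fderiv ℝ (fun w' => fderiv ℝ X w' a) w b = fderiv ℝ (fderiv ℝ X) w b a := by
    intro a b
    rw [fderiv_clm_apply hd (differentiableAt_const a)]
    simp
  have hb : ∀ a b : Fin 3 → ℝ, spaceFormMetric κ a b = spaceFormMetric κ b a := by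
    intro a b
    simp only [spaceFormMetric]
    ring
  simp only [covDeriv, h1, hs, hb (fderiv ℝ X w u).2]
  congr 3
  exact add_comm _ _

end WarpedSurface

end

/-!
All seven formulas follow from four tensorial facts about a surface with unit normal `n` in
`ℝ ×_f 𝕄²(κ)`, written out in the frame `∂_z, ∂_z̄`.

* *Frame expansion.* `ℝ × 𝕄²(κ)` is three-dimensional, so its metric is determined on all tangent
  vectors by their components along `X_1, X_i, n` (`det_mul_warpedMetric`). Here `X_a = dX(a)` for
  the parameter directions `a = 1, i`. The tangential components of `∇̄_b X_a` are Christoffel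
  symbols of the first kind, which determine the first derivatives of `I`
  (`IsConformalPatch.fderiv_firstForm`); its normal component is `II(a, b)`; and `∇̄_b n` is
  tangential with components `-II(a, b)`.
* *`∂_t` is a closed conformal field*, `∇̄_V ∂_t = f' (V - ⟨V, ∂_t⟩ ∂_t)`. With the frame expansion
  this gives the Hessian of `h` (`det_mul_hessian`) and the gradient of `ν`
  (`det_mul_fderiv_angle`).
* *`|∂_t|² = 1`*, that is `α h_z + ᾱ h_z̄ = D (1 - ν²)` (`alpha_mul_add`).
* *The Codazzi equation* (`IsSurfacePatch.codazzi`). The curvature of the warped product enters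
  only through `R̄(c, b) n = (f'' + κ e^{-2f}) ν (h_c X_b - h_b X_c)` (`covDeriv_covDeriv_sub`),
  because `n` is orthogonal to the surface.

In a parameter with `II = 2 ρ |dz|²` the Codazzi equation becomes a formula for
`Γ^1_{12} - Γ^2_{22}` (`codazzi_christoffel`), while `Γ^1_{12} + Γ^2_{22} = D_z̄ / (2 D)` and `K_e D = -ρ²`
express the sum through `ρ` and `K_e`; together they give `Γ^1_{12}` (`christoffel_zero_zero_one`),
and conjugation gives `Γ^2_{12}`. Substituting these symbols in the Hessian of `h` gives
`h_{z z̄}`, and differentiating `α = Ē h_z - F h_z̄` and then `ν_z` gives the last two formulas.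

The passage from real directions to `∂_z, ∂_z̄` is a comparison of coefficients: each complex
identity is a complex combination of the real ones, checked modulo `i² = -1`.
-/

noncomputable section

namespace WarpedSurface

/-! ### Frames of the warped product along a surface -/

theorem spaceFormMetric_comm (κ : ℝ) (v w : Fin 3 → ℝ) :
    spaceFormMetric κ v w = spaceFormMetric κ w v := by
  simp only [spaceFormMetric]; ring

theorem warpedMetric_comm (κ : ℝ) (f : ℝ → ℝ) (x V W : Ambient) :
    warpedMetric κ f x V W = warpedMetric κ f x W V := by
  simp only [warpedMetric, spaceFormMetric]; ring

theorem warpedMetric_add_left (κ : ℝ) (f : ℝ → ℝ) (x V V' W : Ambient) :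
    warpedMetric κ f x (V + V') W = warpedMetric κ f x V W + warpedMetric κ f x V' W := by
  simp only [warpedMetric, spaceFormMetric, Prod.fst_add, Prod.snd_add, Pi.add_apply]; ring

theorem warpedMetric_smul_left (κ : ℝ) (f : ℝ → ℝ) (x : Ambient) (a : ℝ) (V W : Ambient) :
    warpedMetric κ f x (a • V) W = a * warpedMetric κ f x V W := by
  simp only [warpedMetric, spaceFormMetric, Prod.smul_fst, Prod.smul_snd, Pi.smul_apply,
    smul_eq_mul]; ring

theorem warpedMetric_add_right (κ : ℝ) (f : ℝ → ℝ) (x W V V' : Ambient) :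
    warpedMetric κ f x W (V + V') = warpedMetric κ f x W V + warpedMetric κ f x W V' := by
  simp only [warpedMetric_comm κ f x W, warpedMetric_add_left]

theorem warpedMetric_smul_right (κ : ℝ) (f : ℝ → ℝ) (x : Ambient) (a : ℝ) (W V : Ambient) :
    warpedMetric κ f x W (a • V) = a * warpedMetric κ f x W V := by
  simp only [warpedMetric_comm κ f x W, warpedMetric_smul_left]

/-- The linear form on `ℝ × ℝ³` whose kernel is the tangent space of `ℝ × 𝕄²(κ)` at `x`. -/
def ambientTangentForm (κ : ℝ) (x : Ambient) : Ambient →ₗ[ℝ] ℝ where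
  toFun V := κ * (x.2 0 * V.2 0 + x.2 1 * V.2 1) + x.2 2 * V.2 2
  map_add' V W := by simp only [Prod.snd_add, Pi.add_apply]; ring
  map_smul' a V := by
    simp only [Prod.smul_snd, Pi.smul_apply, smul_eq_mul, RingHom.id_apply]; ring

theorem finrank_ker_ambientTangentForm {κ : ℝ} (hκ : κ = -1 ∨ κ = 0 ∨ κ = 1) {x : Ambient}
    (hx : x ∈ warpedProduct κ) :
    Module.finrank ℝ (LinearMap.ker (ambientTangentForm κ x)) = 3 := by
  have hne : ambientTangentForm κ x ≠ 0 := by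
    intro h
    have h0 := LinearMap.congr_fun h (0, Pi.single 0 1)
    have h1 := LinearMap.congr_fun h (0, Pi.single 1 1)
    have h2 := LinearMap.congr_fun h (0, Pi.single 2 1)
    simp [ambientTangentForm] at h0 h1 h2
    obtain ⟨hx, -⟩ := hx
    rcases hκ with rfl | rfl | rfl <;> simp_all
  have h1 := LinearMap.finrank_range_add_finrank_ker (ambientTangentForm κ x)
  have h2 : LinearMap.range (ambientTangentForm κ x) = ⊤ :=
    LinearMap.range_eq_top.2 (LinearMap.surjective hne)
  rw [h2, finrank_top] at h1
  simp at h1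
  omega

/-- A vector tangent to the three-dimensional space `ℝ × 𝕄²(κ)` is a combination of a frame
`A, B, n` whose Gram matrix is block diagonal and invertible. -/
theorem exists_frame_expansion {κ : ℝ} (hκ : κ = -1 ∨ κ = 0 ∨ κ = 1) {f : ℝ → ℝ} {x A B n : Ambient}
    (hx : x ∈ warpedProduct κ) (hA : A ∈ ambientTangent κ x) (hB : B ∈ ambientTangent κ x)
    (hn : n ∈ ambientTangent κ x) (hAn : warpedMetric κ f x A n = 0)
    (hBn : warpedMetric κ f x B n = 0) (hnn : warpedMetric κ f x n n = 1)
    (hdet : warpedMetric κ f x A A * warpedMetric κ f x B B - warpedMetric κ f x A B ^ 2 ≠ 0)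
    {V : Ambient} (hV : V ∈ ambientTangent κ x) :
    ∃ a b s : ℝ, V = a • A + b • B + s • n := by
  let T := LinearMap.ker (ambientTangentForm κ x)
  let v : Fin 3 → T := ![⟨A, hA⟩, ⟨B, hB⟩, ⟨n, hn⟩]
  have hv : LinearIndependent ℝ v := by
    rw [Fintype.linearIndependent_iff]
    intro g hg
    have h0 : g 0 • A + g 1 • B + g 2 • n = 0 := by
      have := congrArg Subtype.val hg
      simpa [Fin.sum_univ_three, v] using this
    have h1 := congrArg (warpedMetric κ f x · n) h0
    have h2 := congrArg (warpedMetric κ f x · A) h0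
    have h3 := congrArg (warpedMetric κ f x · B) h0
    have hz : ∀ W, warpedMetric κ f x 0 W = 0 := by
      intro W; simp [warpedMetric, spaceFormMetric]
    simp only [warpedMetric_add_left, warpedMetric_smul_left, hz, hAn, hBn, hnn,
      warpedMetric_comm κ f x n, warpedMetric_comm κ f x B A] at h1 h2 h3
    have g2 : g 2 = 0 := by linear_combination h1
    have g0 : g 0 = 0 := by
      refine (mul_eq_zero.1 ?_).resolve_right hdet
      linear_combination warpedMetric κ f x B B * h2 - warpedMetric κ f x A B * h3
    have g1 : g 1 = 0 := by
      refine (mul_eq_zero.1 ?_).resolve_right hdet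
      linear_combination warpedMetric κ f x A A * h3 - warpedMetric κ f x A B * h2
    intro i
    fin_cases i <;> assumption
  have hs := hv.span_eq_top_of_card_eq_finrank'
    (by simpa using (finrank_ker_ambientTangentForm hκ hx).symm)
  have hm : (⟨V, hV⟩ : T) ∈ Submodule.span ℝ (Set.range v) := hs ▸ Submodule.mem_top
  obtain ⟨c, hc⟩ := (Submodule.mem_span_range_iff_exists_fun ℝ).1 hm
  refine ⟨c 0, c 1, c 2, ?_⟩
  have := congrArg Subtype.val hc
  simpa [Fin.sum_univ_three, v] using this.symm

/-- The warped metric in terms of the components along the frame `A, B, n`. -/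
theorem det_mul_warpedMetric {κ : ℝ} (hκ : κ = -1 ∨ κ = 0 ∨ κ = 1) {f : ℝ → ℝ} {x A B n : Ambient}
    (hx : x ∈ warpedProduct κ) (hA : A ∈ ambientTangent κ x) (hB : B ∈ ambientTangent κ x)
    (hn : n ∈ ambientTangent κ x) (hAn : warpedMetric κ f x A n = 0)
    (hBn : warpedMetric κ f x B n = 0) (hnn : warpedMetric κ f x n n = 1)
    (hdet : warpedMetric κ f x A A * warpedMetric κ f x B B - warpedMetric κ f x A B ^ 2 ≠ 0)
    {V W : Ambient} (hV : V ∈ ambientTangent κ x) :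
    (warpedMetric κ f x A A * warpedMetric κ f x B B - warpedMetric κ f x A B ^ 2)
        * (warpedMetric κ f x V W - warpedMetric κ f x V n * warpedMetric κ f x W n)
      = warpedMetric κ f x B B * (warpedMetric κ f x V A * warpedMetric κ f x W A)
        - warpedMetric κ f x A B * (warpedMetric κ f x V A * warpedMetric κ f x W B
          + warpedMetric κ f x V B * warpedMetric κ f x W A)
        + warpedMetric κ f x A A * (warpedMetric κ f x V B * warpedMetric κ f x W B) := by
  obtain ⟨a, b, s, rfl⟩ := exists_frame_expansion hκ hx hA hB hn hAn hBn hnn hdet hV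
  simp only [warpedMetric_add_left, warpedMetric_smul_left, hAn, hBn, hnn,
    warpedMetric_comm κ f x n A, warpedMetric_comm κ f x n B, warpedMetric_comm κ f x B A,
    warpedMetric_comm κ f x W]
  ring

/-! ### Curvature of the warped product -/

theorem differentiableAt_fderiv_apply {V : ℂ → Ambient} {w : ℂ}
    (hV : ContDiffAt ℝ 2 V w) (b : ℂ) : DifferentiableAt ℝ (fun w' => fderiv ℝ V w' b) w :=
  ((hV.fderiv_right (m := 1) (by norm_num)).differentiableAt (by norm_num)).clm_apply
    (differentiableAt_const b)

theorem fderiv_fderiv_apply_comm {V : ℂ → Ambient} {w : ℂ}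
    (hV : ContDiffAt ℝ 2 V w) (a b : ℂ) :
    fderiv ℝ (fun w' => fderiv ℝ V w' a) w b = fderiv ℝ (fun w' => fderiv ℝ V w' b) w a := by
  have hd : DifferentiableAt ℝ (fderiv ℝ V) w :=
    (hV.fderiv_right (m := 1) (by norm_num)).differentiableAt (by norm_num)
  rw [fderiv_clm_apply hd (differentiableAt_const a),
    fderiv_clm_apply hd (differentiableAt_const b)]
  simpa using (hV.isSymmSndFDerivAt (by simp)) b a

theorem hasFDerivAt_of_components {V : ℂ → Ambient} {w : ℂ} {L₀ : ℂ →L[ℝ] ℝ}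
    {L : Fin 3 → ℂ →L[ℝ] ℝ} (h₀ : HasFDerivAt (fun w' => (V w').1) L₀ w)
    (h : ∀ i, HasFDerivAt (fun w' => (V w').2 i) (L i) w) :
    HasFDerivAt V (L₀.prod (ContinuousLinearMap.pi L)) w :=
  h₀.prodMk (hasFDerivAt_pi.2 h)

/-- The ordinary derivative in `ℝ × ℝ³` of the field `∇̄_b V` in the direction `c`. The covariant
derivative `∇̄_c ∇̄_b V` adds the correction terms of `covDeriv` to it. -/
theorem fderiv_covDeriv (κ : ℝ) {f : ℝ → ℝ} (hf : ContDiff ℝ ∞ f) {X V : ℂ → Ambient} {w : ℂ}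
    (hX : ContDiffAt ℝ 2 X w) (hV : ContDiffAt ℝ 2 V w) (b : ℂ) :
    DifferentiableAt ℝ (fun w' => covDeriv κ f X V w' b) w ∧ ∀ c,
    fderiv ℝ (fun w' => covDeriv κ f X V w' b) w c =
      let f' := deriv f (X w).1
      let f'' := deriv (deriv f) (X w).1
      let e := Real.exp (2 * f (X w).1)
      let p := (X w).2
      let v := (V w).2
      let Xb := fderiv ℝ X w b
      let Xc := fderiv ℝ X w c
      let Vc := fderiv ℝ V w c
      let Xbc := fderiv ℝ (fun w' => fderiv ℝ X w' b) w c
      let Vbc := fderiv ℝ (fun w' => fderiv ℝ V w' b) w c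
      (Vbc.1 - (f'' * Xc.1 + f' * (2 * f' * Xc.1)) * e * spaceFormMetric κ Xb.2 v
          - f' * e * (spaceFormMetric κ Xbc.2 v + spaceFormMetric κ Xb.2 Vc.2),
        Vbc.2 + (κ * (spaceFormMetric κ Xbc.2 v + spaceFormMetric κ Xb.2 Vc.2)) • p
          + (κ * spaceFormMetric κ Xb.2 v) • Xc.2
          + (f'' * Xc.1) • (Xb.1 • v + (V w).1 • Xb.2)
          + f' • (Xbc.1 • v + Xb.1 • Vc.2 + Vc.1 • Xb.2 + (V w).1 • Xbc.2)) := by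
  obtain ⟨x0, x⟩ := hasFDerivAt_components (hX.differentiableAt (by norm_num))
  obtain ⟨v0, v⟩ := hasFDerivAt_components (hV.differentiableAt (by norm_num))
  obtain ⟨xb0, xb⟩ := hasFDerivAt_components (differentiableAt_fderiv_apply hX b)
  obtain ⟨vb0, vb⟩ := hasFDerivAt_components (differentiableAt_fderiv_apply hV b)
  have hf0 : HasDerivAt f (deriv f (X w).1) (X w).1 :=
    (hf.differentiable (by simp) _).hasDerivAt
  have hf1 : HasDerivAt (deriv f) (deriv (deriv f) (X w).1) (X w).1 :=
    ((contDiff_infty_iff_deriv.1 hf).2.differentiable (by simp) _).hasDerivAt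
  have e0 := ((hf0.comp_hasFDerivAt w x0).const_mul 2).exp
  have e1 := hf1.comp_hasFDerivAt w x0
  have hb := (((xb 0).mul (v 0)).add ((xb 1).mul (v 1))).add (((xb 2).mul (v 2)).const_mul κ)
  have c0 := vb0.sub ((e1.mul e0).mul hb)
  have ci := fun i => ((vb i).add ((hb.const_mul κ).mul (x i))).add
    (e1.mul ((xb0.mul (v i)).add (v0.mul (xb i))))
  have hc : HasFDerivAt (fun w' => covDeriv κ f X V w' b) _ w := hasFDerivAt_of_components
    (V := fun w' => covDeriv κ f X V w' b) c0 ci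
  refine ⟨hc.differentiableAt, fun c => ?_⟩
  rw [hc.fderiv]
  refine Prod.ext ?_ ?_
  · simp [spaceFormMetric]
    ring
  · ext i
    simp [spaceFormMetric]
    ring

/-- The curvature tensor of `ℝ ×_f 𝕄²(κ)` on a vector orthogonal to the plane `dX(ℂ)`: there only
the difference `f'' + κ e^{-2f}` between the two kinds of sectional curvatures contributes. -/
theorem covDeriv_covDeriv_sub {κ : ℝ} (hκ : κ = -1 ∨ κ = 0 ∨ κ = 1) {f : ℝ → ℝ}
    (hf : ContDiff ℝ ∞ f) {X V : ℂ → Ambient} {w : ℂ}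
    (hX : ContDiffAt ℝ 2 X w) (hV : ContDiffAt ℝ 2 V w) {b c : ℂ}
    (hb : fderiv ℝ X w b ∈ ambientTangent κ (X w)) (hc : fderiv ℝ X w c ∈ ambientTangent κ (X w))
    (hbV : warpedMetric κ f (X w) (fderiv ℝ X w b) (V w) = 0)
    (hcV : warpedMetric κ f (X w) (fderiv ℝ X w c) (V w) = 0) :
    covDeriv κ f X (fun w' => covDeriv κ f X V w' b) w c
      - covDeriv κ f X (fun w' => covDeriv κ f X V w' c) w b =
    ((deriv (deriv f) (X w).1 + κ * Real.exp (-2 * f (X w).1)) * (V w).1) •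
      ((fderiv ℝ X w c).1 • fderiv ℝ X w b - (fderiv ℝ X w b).1 • fderiv ℝ X w c) := by
  have sX := fderiv_fderiv_apply_comm hX c b
  have sV := fderiv_fderiv_apply_comm hV c b
  -- tangent vectors are orthogonal to the position vector; for `κ = 0` the factor `κ` is needed
  have hp : ∀ u, fderiv ℝ X w u ∈ ambientTangent κ (X w) →
      κ * spaceFormMetric κ (fderiv ℝ X w u).2 (X w).2 = 0 := by
    intro u hu
    simp only [ambientTangent, Set.mem_ofPred_eq] at hu
    simp only [spaceFormMetric]
    rcases hκ with rfl | rfl | rfl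
    · linear_combination hu
    · ring
    · linear_combination hu
  have hb' := hp b hb
  have hc' := hp c hc
  have he : Real.exp (2 * f (X w).1) * Real.exp (-2 * f (X w).1) = 1 := by
    rw [← Real.exp_add]; simp
  -- orthogonality to `V` expresses the space form part of the metric through the heights
  have hbV' : spaceFormMetric κ (fderiv ℝ X w b).2 (V w).2
      = -Real.exp (-2 * f (X w).1) * ((fderiv ℝ X w b).1 * (V w).1) := by
    simp only [warpedMetric] at hbV
    linear_combination Real.exp (-2 * f (X w).1) * hbV
      - spaceFormMetric κ (fderiv ℝ X w b).2 (V w).2 * he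
  have hcV' : spaceFormMetric κ (fderiv ℝ X w c).2 (V w).2
      = -Real.exp (-2 * f (X w).1) * ((fderiv ℝ X w c).1 * (V w).1) := by
    simp only [warpedMetric] at hcV
    linear_combination Real.exp (-2 * f (X w).1) * hcV
      - spaceFormMetric κ (fderiv ℝ X w c).2 (V w).2 * he
  have sa : ∀ u v v', spaceFormMetric κ u (v + v') =
      spaceFormMetric κ u v + spaceFormMetric κ u v' := by
    intro u v v'; simp only [spaceFormMetric, Pi.add_apply]; ring
  have ss : ∀ u (a : ℝ) v, spaceFormMetric κ u (a • v) = a * spaceFormMetric κ u v := by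
    intro u a v; simp only [spaceFormMetric, Pi.smul_apply, smul_eq_mul]; ring
  have db := (fderiv_covDeriv κ hf hX hV b).2 c
  have dc := (fderiv_covDeriv κ hf hX hV c).2 b
  rw [sX, sV] at dc
  have hcov : ∀ W : ℂ → Ambient, ∀ u, covDeriv κ f X W w u =
      ((fderiv ℝ W w u).1 - deriv f (X w).1 * Real.exp (2 * f (X w).1)
          * spaceFormMetric κ (fderiv ℝ X w u).2 (W w).2,
        (fderiv ℝ W w u).2 + (κ * spaceFormMetric κ (fderiv ℝ X w u).2 (W w).2) • (X w).2
          + deriv f (X w).1 • ((fderiv ℝ X w u).1 • (W w).2 + (W w).1 • (fderiv ℝ X w u).2)) :=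
    fun W u => rfl
  rw [hcov (fun w' => covDeriv κ f X V w' b), hcov (fun w' => covDeriv κ f X V w' c)]
  dsimp only at db dc
  rw [db, dc]
  have hcomm := spaceFormMetric_comm κ (fderiv ℝ X w b).2 (fderiv ℝ X w c).2
  simp only [hcov, sa, ss, hbV', hcV', hcomm]
  clear db dc sX sV
  set e := Real.exp (2 * f (X w).1)
  set e' := Real.exp (-2 * f (X w).1)
  set s1 := spaceFormMetric κ (fderiv ℝ X w b).2 (X w).2
  set s2 := spaceFormMetric κ (fderiv ℝ X w c).2 (X w).2
  refine Prod.ext ?_ ?_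
  · simp only [Prod.fst_sub, Prod.smul_fst, smul_eq_mul]
    linear_combination deriv f (X w).1 * e * e' * (V w).1
      * ((fderiv ℝ X w b).1 * hc' - (fderiv ℝ X w c).1 * hb')
  · ext i
    simp only [Prod.snd_sub, Prod.smul_snd, smul_eq_mul, Pi.sub_apply, Pi.add_apply, Pi.smul_apply]
    linear_combination -κ * (X w).2 i * e' * (V w).1
        * ((fderiv ℝ X w b).1 * hc' - (fderiv ℝ X w c).1 * hb')
      + (V w).1 * deriv f (X w).1 ^ 2 * ((fderiv ℝ X w b).1 * (fderiv ℝ X w c).2 i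
        - (fderiv ℝ X w c).1 * (fderiv ℝ X w b).2 i) * he

/-! ### The equations of a surface in real coordinates -/

/-- `X` is a smooth map from the open set `U` of parameters to `ℝ ×_f 𝕄²(κ)`, and `n` is a smooth
unit normal field along it. -/
structure IsSurfacePatch (κ : ℝ) (f : ℝ → ℝ) (X n : ℂ → Ambient) (U : Set ℂ) : Prop where
  isOpen : IsOpen U
  smooth : ∀ w ∈ U, ContDiffAt ℝ ∞ X w
  smooth_normal : ∀ w ∈ U, ContDiffAt ℝ ∞ n w
  mem : ∀ w ∈ U, X w ∈ warpedProduct κ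
  normal_tangent : ∀ w ∈ U, n w ∈ ambientTangent κ (X w)
  unit : ∀ w ∈ U, warpedMetric κ f (X w) (n w) (n w) = 1
  normal : ∀ w ∈ U, ∀ u, warpedMetric κ f (X w) (fderiv ℝ X w u) (n w) = 0

/-- The covariant derivative `∇̄_b X_a` of the coordinate field `X_a = dX(a)`. -/
def coordDeriv (κ : ℝ) (f : ℝ → ℝ) (X : ℂ → Ambient) (a b w : ℂ) : Ambient :=
  covDeriv κ f X (fun w' => fderiv ℝ X w' a) w b

theorem differentiableAt_warpedMetric (κ : ℝ) {f : ℝ → ℝ} (hf : ContDiff ℝ ∞ f)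
    {X V W : ℂ → Ambient} {w : ℂ} (hX : DifferentiableAt ℝ X w) (hV : DifferentiableAt ℝ V w)
    (hW : DifferentiableAt ℝ W w) :
    DifferentiableAt ℝ (fun w' => warpedMetric κ f (X w') (V w') (W w')) w := by
  obtain ⟨x0, -⟩ := hasFDerivAt_components hX
  obtain ⟨v0, v⟩ := hasFDerivAt_components hV
  obtain ⟨y0, y⟩ := hasFDerivAt_components hW
  have hf0 : HasDerivAt f (deriv f (X w).1) (X w).1 :=
    (hf.differentiable (by simp) _).hasDerivAt
  exact ((v0.mul y0).add (((hf0.comp_hasFDerivAt w x0).const_mul 2).exp.mul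
    ((((v 0).mul (y 0)).add ((v 1).mul (y 1))).add
      (((v 2).mul (y 2)).const_mul κ)))).differentiableAt

theorem covDeriv_add (κ : ℝ) (f : ℝ → ℝ) (X V : ℂ → Ambient) (w u v : ℂ) :
    covDeriv κ f X V w (u + v) = covDeriv κ f X V w u + covDeriv κ f X V w v := by
  refine Prod.ext ?_ ?_
  · simp [covDeriv, spaceFormMetric]; ring
  · ext i
    simp [covDeriv, spaceFormMetric]; ring

theorem secondForm_add_self (κ : ℝ) (f : ℝ → ℝ) (X n : ℂ → Ambient) (w u v : ℂ) :
    secondForm κ f X n w (u + v) (u + v) = secondForm κ f X n w u u + secondForm κ f X n w u v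
      + (secondForm κ f X n w v u + secondForm κ f X n w v v) := by
  simp only [secondForm, covDeriv_add, map_add, warpedMetric_add_left, warpedMetric_add_right]
  ring

theorem firstForm_comm (κ : ℝ) (f : ℝ → ℝ) (X : ℂ → Ambient) (w u v : ℂ) :
    firstForm κ f X w u v = firstForm κ f X w v u :=
  warpedMetric_comm ..

theorem warpedMetric_xi (κ : ℝ) (f : ℝ → ℝ) (x V : Ambient) : warpedMetric κ f x xi V = V.1 := by
  simp [warpedMetric, spaceFormMetric, xi]

theorem xi_mem (κ : ℝ) (x : Ambient) : xi ∈ ambientTangent κ x := by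
  simp [ambientTangent, xi]

namespace IsSurfacePatch

variable {κ : ℝ} {f : ℝ → ℝ} {X n : ℂ → Ambient} {U : Set ℂ} {w : ℂ}

theorem eventually_mem (hP : IsSurfacePatch κ f X n U) (hw : w ∈ U) : ∀ᶠ w' in nhds w, w' ∈ U :=
  hP.isOpen.mem_nhds hw

theorem contDiffAt_two (hP : IsSurfacePatch κ f X n U) (hw : w ∈ U) : ContDiffAt ℝ 2 X w :=
  (hP.smooth w hw).of_le (WithTop.coe_le_coe.2 le_top)

theorem contDiffAt_normal_two (hP : IsSurfacePatch κ f X n U) (hw : w ∈ U) : ContDiffAt ℝ 2 n w :=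
  (hP.smooth_normal w hw).of_le (WithTop.coe_le_coe.2 le_top)

theorem differentiableAt (hP : IsSurfacePatch κ f X n U) (hw : w ∈ U) : DifferentiableAt ℝ X w :=
  (hP.contDiffAt_two hw).differentiableAt (by norm_num)

theorem differentiableAt_normal (hP : IsSurfacePatch κ f X n U) (hw : w ∈ U) :
    DifferentiableAt ℝ n w :=
  (hP.contDiffAt_normal_two hw).differentiableAt (by norm_num)

theorem differentiableAt_coord (hP : IsSurfacePatch κ f X n U) (hw : w ∈ U) (a : ℂ) :
    DifferentiableAt ℝ (fun w' => fderiv ℝ X w' a) w :=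
  differentiableAt_fderiv_apply (hP.contDiffAt_two hw) a

theorem coord_mem (hP : IsSurfacePatch κ f X n U) (hw : w ∈ U) (u : ℂ) :
    fderiv ℝ X w u ∈ ambientTangent κ (X w) := by
  obtain ⟨-, x⟩ := hasFDerivAt_components (hP.differentiableAt hw)
  have e := (((((x 0).mul (x 0)).add ((x 1).mul (x 1))).const_mul κ).add ((x 2).mul (x 2))).unique
    ((hasFDerivAt_const (1 : ℝ) w).congr_of_eventuallyEq
      ((hP.eventually_mem hw).mono fun w' h => by
        have := (hP.mem w' h).1
        simp only [pow_two] at this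
        exact this))
  have e := congrArg (fun L : ℂ →L[ℝ] ℝ => L u) e
  simp only [add_apply, smul_apply, smul_eq_mul,
    ContinuousLinearMap.comp_apply, ContinuousLinearMap.proj_apply,
    ContinuousLinearMap.coe_snd', zero_apply] at e
  simp only [ambientTangent, Set.mem_ofPred_eq]
  linear_combination e / 2

theorem covDeriv_mem (hP : IsSurfacePatch κ f X n U) (hκ : κ = -1 ∨ κ = 0 ∨ κ = 1) (hw : w ∈ U)
    {V : ℂ → Ambient} (hV : DifferentiableAt ℝ V w)
    (hVm : ∀ w' ∈ U, V w' ∈ ambientTangent κ (X w')) (u : ℂ) :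
    covDeriv κ f X V w u ∈ ambientTangent κ (X w) :=
  covDeriv_mem_ambientTangent hκ f (hP.differentiableAt hw) hV
    ((hP.eventually_mem hw).mono hP.mem) ((hP.eventually_mem hw).mono hVm) u

theorem coordDeriv_mem (hP : IsSurfacePatch κ f X n U) (hκ : κ = -1 ∨ κ = 0 ∨ κ = 1) (hw : w ∈ U)
    (a b : ℂ) : coordDeriv κ f X a b w ∈ ambientTangent κ (X w) :=
  hP.covDeriv_mem hκ hw (hP.differentiableAt_coord hw a) (fun _ h => hP.coord_mem h a) b

theorem coordDeriv_comm (hP : IsSurfacePatch κ f X n U) (hw : w ∈ U) (a b : ℂ) :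
    coordDeriv κ f X a b w = coordDeriv κ f X b a w :=
  covDeriv_symm κ f (hP.contDiffAt_two hw) b a

theorem differentiableAt_firstForm (hP : IsSurfacePatch κ f X n U) (hf : ContDiff ℝ ∞ f)
    (hw : w ∈ U) (a b : ℂ) : DifferentiableAt ℝ (fun w' => firstForm κ f X w' a b) w :=
  differentiableAt_warpedMetric κ hf (hP.differentiableAt hw) (hP.differentiableAt_coord hw a)
    (hP.differentiableAt_coord hw b)

theorem differentiableAt_secondForm (hP : IsSurfacePatch κ f X n U) (hf : ContDiff ℝ ∞ f)
    (hw : w ∈ U) (a b : ℂ) : DifferentiableAt ℝ (fun w' => secondForm κ f X n w' a b) w :=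
  (differentiableAt_warpedMetric κ hf (hP.differentiableAt hw) (hP.differentiableAt_coord hw a)
    (fderiv_covDeriv κ hf (hP.contDiffAt_two hw) (hP.contDiffAt_normal_two hw) b).1).neg

theorem fderiv_firstForm (hP : IsSurfacePatch κ f X n U) (hκ : κ = -1 ∨ κ = 0 ∨ κ = 1)
    (hf : ContDiff ℝ ∞ f) (hw : w ∈ U) (a b c : ℂ) :
    fderiv ℝ (fun w' => firstForm κ f X w' a b) w c =
      warpedMetric κ f (X w) (coordDeriv κ f X a c w) (fderiv ℝ X w b)
        + warpedMetric κ f (X w) (fderiv ℝ X w a) (coordDeriv κ f X b c w) :=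
  covDeriv_compatible hκ (hf.differentiable (by simp) _) (hP.differentiableAt hw)
    (hP.differentiableAt_coord hw a) (hP.differentiableAt_coord hw b)
    (hP.coord_mem hw a) (hP.coord_mem hw b) c

/-- The normal component of `∇̄_b X_a` is the second fundamental form. -/
theorem warpedMetric_coordDeriv_normal (hP : IsSurfacePatch κ f X n U)
    (hκ : κ = -1 ∨ κ = 0 ∨ κ = 1) (hf : ContDiff ℝ ∞ f) (hw : w ∈ U) (a b : ℂ) :
    warpedMetric κ f (X w) (coordDeriv κ f X a b w) (n w) = secondForm κ f X n w a b := by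
  have h := covDeriv_compatible hκ (hf.differentiable (by simp) _) (hP.differentiableAt hw)
    (hP.differentiableAt_coord hw a) (hP.differentiableAt_normal hw)
    (hP.coord_mem hw a) (hP.normal_tangent w hw) b
  have h0 : fderiv ℝ (fun w' => warpedMetric κ f (X w') (fderiv ℝ X w' a) (n w')) w = 0 :=
    ((hasFDerivAt_const (0 : ℝ) w).congr_of_eventuallyEq
      ((hP.eventually_mem hw).mono fun w' h => hP.normal w' h a)).fderiv
  rw [h0] at h
  simp only [secondForm, coordDeriv]
  simp only [zero_apply] at h
  linarith

theorem secondForm_comm (hP : IsSurfacePatch κ f X n U)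
    (hκ : κ = -1 ∨ κ = 0 ∨ κ = 1) (hf : ContDiff ℝ ∞ f) (hw : w ∈ U) (a b : ℂ) :
    secondForm κ f X n w a b = secondForm κ f X n w b a := by
  rw [← hP.warpedMetric_coordDeriv_normal hκ hf hw, hP.coordDeriv_comm hw,
    hP.warpedMetric_coordDeriv_normal hκ hf hw]

theorem covDeriv_normal_normal (hP : IsSurfacePatch κ f X n U)
    (hκ : κ = -1 ∨ κ = 0 ∨ κ = 1) (hf : ContDiff ℝ ∞ f) (hw : w ∈ U) (b : ℂ) :
    warpedMetric κ f (X w) (covDeriv κ f X n w b) (n w) = 0 := by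
  have h := covDeriv_compatible hκ (hf.differentiable (by simp) _) (hP.differentiableAt hw)
    (hP.differentiableAt_normal hw) (hP.differentiableAt_normal hw)
    (hP.normal_tangent w hw) (hP.normal_tangent w hw) b
  have h0 : fderiv ℝ (fun w' => warpedMetric κ f (X w') (n w') (n w')) w = 0 :=
    ((hasFDerivAt_const (1 : ℝ) w).congr_of_eventuallyEq
      ((hP.eventually_mem hw).mono fun w' h => hP.unit w' h)).fderiv
  rw [h0, warpedMetric_comm κ f (X w) (n w)] at h
  simp only [zero_apply] at h
  linarith

theorem fderiv_height (hP : IsSurfacePatch κ f X n U) (hw : w ∈ U) (a : ℂ) :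
    fderiv ℝ (height X) w a = (fderiv ℝ X w a).1 := by
  have h : fderiv ℝ (height X) w = _ := (hasFDerivAt_components (hP.differentiableAt hw)).1.fderiv
  rw [h]; rfl

theorem hasFDerivAt_fderiv_height (hP : IsSurfacePatch κ f X n U) (hw : w ∈ U) (a : ℂ) :
    HasFDerivAt (fun w' => fderiv ℝ (height X) w' a)
      ((ContinuousLinearMap.fst ℝ ℝ (Fin 3 → ℝ)).comp
        (fderiv ℝ (fun w' => fderiv ℝ X w' a) w)) w :=
  (hasFDerivAt_components (hP.differentiableAt_coord hw a)).1.congr_of_eventuallyEq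
    ((hP.eventually_mem hw).mono fun _ h => hP.fderiv_height h a)

/-- The Hessian of the height function: `∂_t` fails to be parallel only through `f'`. -/
theorem fderiv_fderiv_height (hP : IsSurfacePatch κ f X n U) (hw : w ∈ U) (a b : ℂ) :
    fderiv ℝ (fun w' => fderiv ℝ (height X) w' a) w b = (coordDeriv κ f X a b w).1
      + deriv f (height X w) * (firstForm κ f X w a b
        - fderiv ℝ (height X) w a * fderiv ℝ (height X) w b) := by
  rw [(hP.hasFDerivAt_fderiv_height hw a).fderiv, hP.fderiv_height hw, hP.fderiv_height hw]
  simp only [ContinuousLinearMap.comp_apply, ContinuousLinearMap.coe_fst', coordDeriv, covDeriv,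
    firstForm, warpedMetric, height, spaceFormMetric]
  ring

theorem angle_eq (X n : ℂ → Ambient) (w : ℂ) : angle κ f X n w = (n w).1 :=
  warpedMetric_xi ..

theorem hasFDerivAt_angle (hP : IsSurfacePatch κ f X n U) (hw : w ∈ U) :
    HasFDerivAt (angle κ f X n)
      ((ContinuousLinearMap.fst ℝ ℝ (Fin 3 → ℝ)).comp (fderiv ℝ n w)) w :=
  (hasFDerivAt_components (hP.differentiableAt_normal hw)).1.congr_of_eventuallyEq
    (Filter.Eventually.of_forall fun _ => angle_eq ..)

theorem fderiv_angle (hP : IsSurfacePatch κ f X n U) (hw : w ∈ U) (a : ℂ) :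
    fderiv ℝ (angle κ f X n) w a = (covDeriv κ f X n w a).1
      - deriv f (height X w) * (fderiv ℝ (height X) w a * angle κ f X n w) := by
  have h := hP.normal w hw a
  rw [(hP.hasFDerivAt_angle hw).fderiv, hP.fderiv_height hw, angle_eq]
  simp only [warpedMetric] at h
  simp only [ContinuousLinearMap.comp_apply, ContinuousLinearMap.coe_fst', covDeriv, height]
  linear_combination (deriv f (X w).1) * h

/-- The Codazzi equation. -/
theorem codazzi (hP : IsSurfacePatch κ f X n U) (hκ : κ = -1 ∨ κ = 0 ∨ κ = 1)
    (hf : ContDiff ℝ ∞ f) (hw : w ∈ U) (a b c : ℂ) :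
    fderiv ℝ (fun w' => secondForm κ f X n w' a b) w c
        - fderiv ℝ (fun w' => secondForm κ f X n w' a c) w b =
      warpedMetric κ f (X w) (coordDeriv κ f X a b w) (covDeriv κ f X n w c)
        - warpedMetric κ f (X w) (coordDeriv κ f X a c w) (covDeriv κ f X n w b)
        - (deriv (deriv f) (height X w) + κ * Real.exp (-2 * f (height X w))) * angle κ f X n w
          * (fderiv ℝ (height X) w c * firstForm κ f X w a b
            - fderiv ℝ (height X) w b * firstForm κ f X w a c) := by
  have key : ∀ b c, fderiv ℝ (fun w' => secondForm κ f X n w' a b) w c =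
      -(warpedMetric κ f (X w) (coordDeriv κ f X a c w) (covDeriv κ f X n w b)
        + warpedMetric κ f (X w) (fderiv ℝ X w a)
          (covDeriv κ f X (fun w' => covDeriv κ f X n w' b) w c)) := by
    intro b c
    have hd := (fderiv_covDeriv κ hf (hP.contDiffAt_two hw)
      (hP.contDiffAt_normal_two hw) b).1
    have h := covDeriv_compatible hκ (hf.differentiable (by simp) _) (hP.differentiableAt hw)
      (hP.differentiableAt_coord hw a) hd (hP.coord_mem hw a)
      (hP.covDeriv_mem hκ hw (hP.differentiableAt_normal hw) hP.normal_tangent b) c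
    have h2 : fderiv ℝ (fun w' => secondForm κ f X n w' a b) w = _ :=
      (differentiableAt_warpedMetric κ hf (hP.differentiableAt hw)
        (hP.differentiableAt_coord hw a) hd).hasFDerivAt.neg.fderiv
    rw [h2]
    simp only [neg_apply]
    rw [h]; rfl
  -- antisymmetrize in `b, c`: the second derivatives of `n` combine to the curvature term
  have hR := covDeriv_covDeriv_sub hκ hf (hP.contDiffAt_two hw) (hP.contDiffAt_normal_two hw)
    (hP.coord_mem hw b) (hP.coord_mem hw c) (hP.normal w hw b) (hP.normal w hw c)
  have hR := congrArg (warpedMetric κ f (X w) (fderiv ℝ X w a)) hR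
  simp only [sub_eq_add_neg, ← neg_one_smul ℝ (_ : Ambient), warpedMetric_add_right,
    warpedMetric_smul_right] at hR
  rw [key, key, hP.fderiv_height hw, hP.fderiv_height hw, angle_eq]
  simp only [firstForm, height]
  linear_combination -hR

/-- The metric in terms of the components along `X_1, X_i, n`. -/
theorem det_mul_warpedMetric (hP : IsSurfacePatch κ f X n U) (hκ : κ = -1 ∨ κ = 0 ∨ κ = 1)
    (hw : w ∈ U) (hdet : firstForm κ f X w 1 1 * firstForm κ f X w Complex.I Complex.I
      - firstForm κ f X w 1 Complex.I ^ 2 ≠ 0)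
    {V W : Ambient} (hV : V ∈ ambientTangent κ (X w)) :
    (firstForm κ f X w 1 1 * firstForm κ f X w Complex.I Complex.I
      - firstForm κ f X w 1 Complex.I ^ 2)
        * (warpedMetric κ f (X w) V W
          - warpedMetric κ f (X w) V (n w) * warpedMetric κ f (X w) W (n w)) =
      firstForm κ f X w Complex.I Complex.I * (warpedMetric κ f (X w) V (fderiv ℝ X w 1)
          * warpedMetric κ f (X w) W (fderiv ℝ X w 1))
        - firstForm κ f X w 1 Complex.I
          * (warpedMetric κ f (X w) V (fderiv ℝ X w 1)
              * warpedMetric κ f (X w) W (fderiv ℝ X w Complex.I)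
            + warpedMetric κ f (X w) V (fderiv ℝ X w Complex.I)
              * warpedMetric κ f (X w) W (fderiv ℝ X w 1))
        + firstForm κ f X w 1 1 * (warpedMetric κ f (X w) V (fderiv ℝ X w Complex.I)
          * warpedMetric κ f (X w) W (fderiv ℝ X w Complex.I)) :=
  WarpedSurface.det_mul_warpedMetric hκ (hP.mem w hw) (hP.coord_mem hw 1)
    (hP.coord_mem hw Complex.I) (hP.normal_tangent w hw) (hP.normal w hw 1)
    (hP.normal w hw Complex.I) (hP.unit w hw) hdet hV

end IsSurfacePatch

/-! ### Wirtinger derivatives -/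

section Wirtinger

variable {g k : ℂ → ℂ} {w : ℂ}

theorem dz_congr (h : g =ᶠ[nhds w] k) : dz g w = dz k w := by
  simp only [dz, h.fderiv_eq]

theorem dzbar_congr (h : g =ᶠ[nhds w] k) : dzbar g w = dzbar k w := by
  simp only [dzbar, h.fderiv_eq]

theorem dz_sub (hg : DifferentiableAt ℝ g w) (hk : DifferentiableAt ℝ k w) :
    dz (fun w' => g w' - k w') w = dz g w - dz k w := by
  simp only [dz, fderiv_fun_sub hg hk, sub_apply]; ring

theorem dz_mul (hg : DifferentiableAt ℝ g w) (hk : DifferentiableAt ℝ k w) :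
    dz (fun w' => g w' * k w') w = dz g w * k w + g w * dz k w := by
  simp only [dz, fderiv_fun_mul hg hk, add_apply, smul_apply, smul_eq_mul]; ring

theorem dz_const_mul (a : ℂ) (hg : DifferentiableAt ℝ g w) :
    dz (fun w' => a * g w') w = a * dz g w := by
  simp only [dz, fderiv_const_mul hg, smul_apply, smul_eq_mul]; ring

theorem dzbar_sub (hg : DifferentiableAt ℝ g w) (hk : DifferentiableAt ℝ k w) :
    dzbar (fun w' => g w' - k w') w = dzbar g w - dzbar k w := by
  simp only [dzbar, fderiv_fun_sub hg hk, sub_apply]; ring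

theorem dzbar_mul (hg : DifferentiableAt ℝ g w) (hk : DifferentiableAt ℝ k w) :
    dzbar (fun w' => g w' * k w') w = dzbar g w * k w + g w * dzbar k w := by
  simp only [dzbar, fderiv_fun_mul hg hk, add_apply, smul_apply, smul_eq_mul]; ring

theorem dzbar_const_mul (a : ℂ) (hg : DifferentiableAt ℝ g w) :
    dzbar (fun w' => a * g w') w = a * dzbar g w := by
  simp only [dzbar, fderiv_const_mul hg, smul_apply, smul_eq_mul]; ring

theorem fderiv_conj_apply (hg : DifferentiableAt ℝ g w) (u : ℂ) :
    fderiv ℝ (fun w' => conj (g w')) w u = conj (fderiv ℝ g w u) := by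
  have h : HasFDerivAt (fun w' => conj (g w')) _ w :=
    Complex.conjCLE.toContinuousLinearMap.hasFDerivAt.comp w hg.hasFDerivAt
  rw [h.fderiv]; rfl

theorem differentiableAt_conj (hg : DifferentiableAt ℝ g w) :
    DifferentiableAt ℝ (fun w' => conj (g w')) w :=
  Complex.conjCLE.toContinuousLinearMap.differentiableAt.comp w hg

theorem dz_conj (hg : DifferentiableAt ℝ g w) :
    dz (fun w' => conj (g w')) w = conj (dzbar g w) := by
  simp only [dz, dzbar, fderiv_conj_apply hg, map_div₀, map_add, map_mul, Complex.conj_I,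
    map_ofNat]
  ring

theorem dzbar_conj (hg : DifferentiableAt ℝ g w) :
    dzbar (fun w' => conj (g w')) w = conj (dz g w) := by
  simp only [dz, dzbar, fderiv_conj_apply hg, map_div₀, map_sub, map_mul, Complex.conj_I,
    map_ofNat]
  ring

variable {q : ℂ → ℝ}

theorem differentiableAt_ofReal (hq : DifferentiableAt ℝ q w) :
    DifferentiableAt ℝ (fun w' => (q w' : ℂ)) w :=
  Complex.ofRealCLM.differentiableAt.comp w hq

theorem fderiv_ofReal_apply (hq : DifferentiableAt ℝ q w) (u : ℂ) :
    fderiv ℝ (fun w' => (q w' : ℂ)) w u = (fderiv ℝ q w u : ℂ) := by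
  have h : HasFDerivAt (fun w' => (q w' : ℂ)) _ w :=
    Complex.ofRealCLM.hasFDerivAt.comp w hq.hasFDerivAt
  rw [h.fderiv]; rfl

theorem dz_ofReal (hq : DifferentiableAt ℝ q w) :
    dz (fun w' => (q w' : ℂ)) w = (fderiv ℝ q w 1 - Complex.I * fderiv ℝ q w Complex.I) / 2 := by
  simp only [dz, fderiv_ofReal_apply hq]

theorem dzbar_ofReal (hq : DifferentiableAt ℝ q w) :
    dzbar (fun w' => (q w' : ℂ)) w
      = (fderiv ℝ q w 1 + Complex.I * fderiv ℝ q w Complex.I) / 2 := by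
  simp only [dzbar, fderiv_ofReal_apply hq]

theorem conj_dz_ofReal (hq : DifferentiableAt ℝ q w) :
    conj (dz (fun w' => (q w' : ℂ)) w) = dzbar (fun w' => (q w' : ℂ)) w := by
  rw [← dzbar_conj (differentiableAt_ofReal hq)]
  simp only [Complex.conj_ofReal]

end Wirtinger

/-! ### The first fundamental form in the complex frame -/

theorem coeffD_eq (κ : ℝ) (f : ℝ → ℝ) (X : ℂ → Ambient) (w : ℂ) :
    coeffD κ f X w = -(firstForm κ f X w 1 1 * firstForm κ f X w Complex.I Complex.I
      - firstForm κ f X w 1 Complex.I ^ 2) / 4 := by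
  have h : coeffE κ f X w = ⟨(firstForm κ f X w 1 1 - firstForm κ f X w Complex.I Complex.I) / 4,
      -(firstForm κ f X w 1 Complex.I) / 2⟩ := by
    apply Complex.ext
    · simp [coeffE]
    · simp [coeffE]; ring
  rw [coeffD, coeffF, h, ← Complex.normSq_eq_norm_sq, Complex.normSq_mk]
  ring

theorem coeffD_eq_mul (κ : ℝ) (f : ℝ → ℝ) (X : ℂ → Ambient) (w : ℂ) :
    (coeffD κ f X w : ℂ) = coeffE κ f X w * conj (coeffE κ f X w) - (coeffF κ f X w : ℂ) ^ 2 := by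
  rw [coeffD, Complex.mul_conj, Complex.normSq_eq_norm_sq]
  push_cast; ring

theorem conj_coeffE (κ : ℝ) (f : ℝ → ℝ) (X : ℂ → Ambient) (w : ℂ) :
    conj (coeffE κ f X w) = ((firstForm κ f X w 1 1 - firstForm κ f X w Complex.I Complex.I : ℝ)
    + 2 * Complex.I * (firstForm κ f X w 1 Complex.I : ℝ)) / 4 := by
  simp only [coeffE, map_div₀, map_sub, map_mul, Complex.conj_ofReal, Complex.conj_I, map_ofNat]
  ring

/-- The Christoffel symbols with the upper index lowered. -/
theorem christoffel_lower {κ : ℝ} {f : ℝ → ℝ} {X : ℂ → Ambient} {w : ℂ}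
    (hD : (coeffD κ f X w : ℂ) ≠ 0) (i j l : Fin 2) :
    ∑ k, metricMatrix κ f X w l k * christoffel κ f X k i j w =
      (1 / 2) * (frameDeriv i (fun w' => metricMatrix κ f X w' j l) w
      + frameDeriv j (fun w' => metricMatrix κ f X w' i l) w
      - frameDeriv l (fun w' => metricMatrix κ f X w' i j) w) := by
  have hdet : IsUnit (metricMatrix κ f X w).det := by
    rw [isUnit_iff_ne_zero]
    convert hD using 1
    rw [coeffD_eq_mul, metricMatrix, Matrix.det_fin_two_of]; ring
  have h := congrArg (fun A => Matrix.mulVec A (fun l =>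
    (1 / 2) * (frameDeriv i (fun w' => metricMatrix κ f X w' j l) w
      + frameDeriv j (fun w' => metricMatrix κ f X w' i l) w
      - frameDeriv l (fun w' => metricMatrix κ f X w' i j) w)) l)
    (Matrix.mul_nonsing_inv (metricMatrix κ f X w) hdet)
  simp only [← Matrix.mulVec_mulVec, Matrix.one_mulVec] at h
  rw [← h]
  simp only [christoffel, Matrix.mulVec, dotProduct]
  refine Finset.sum_congr rfl fun k _ => ?_
  rw [Finset.mul_sum]
  congr 1
  exact Finset.sum_congr rfl fun l _ => by ring

/-! ### The equations of a surface in a complex parameter -/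

/-- A surface patch of positive extrinsic curvature in a parameter that is conformal for the second
fundamental form `II = 2 r |dz|²`. -/
structure IsConformalPatch (κ : ℝ) (f : ℝ → ℝ) (X n : ℂ → Ambient) (U : Set ℂ) (r : ℂ → ℝ) : Prop
    extends IsSurfacePatch κ f X n U where
  curvature_eq : κ = -1 ∨ κ = 0 ∨ κ = 1
  smooth_warping : ContDiff ℝ ∞ f
  secondForm_self : ∀ w ∈ U, ∀ u, secondForm κ f X n w u u = 2 * r w * ‖u‖ ^ 2
  extrinsicCurvature_pos : ∀ w ∈ U, 0 < extrinsicCurvature κ f X n w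

namespace IsConformalPatch

variable {κ : ℝ} {f : ℝ → ℝ} {X n : ℂ → Ambient} {U : Set ℂ} {r : ℂ → ℝ} {w : ℂ}

theorem secondForm_one_one (hP : IsConformalPatch κ f X n U r) (hw : w ∈ U) :
    secondForm κ f X n w 1 1 = 2 * r w := by
  simp [hP.secondForm_self w hw]

theorem secondForm_I_I (hP : IsConformalPatch κ f X n U r) (hw : w ∈ U) :
    secondForm κ f X n w Complex.I Complex.I = 2 * r w := by
  simp [hP.secondForm_self w hw]

theorem secondForm_one_I (hP : IsConformalPatch κ f X n U r) (hw : w ∈ U) :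
    secondForm κ f X n w 1 Complex.I = 0 := by
  have h := secondForm_add_self κ f X n w 1 Complex.I
  -- polarization of the quadratic form at `1 + i`
  have h2 : ‖(1 + Complex.I : ℂ)‖ ^ 2 = 2 := by
    rw [← Complex.normSq_eq_norm_sq, Complex.normSq_apply]; norm_num
  rw [hP.secondForm_self w hw, h2, hP.secondForm_one_one hw, hP.secondForm_I_I hw,
    hP.toIsSurfacePatch.secondForm_comm hP.curvature_eq hP.smooth_warping hw Complex.I 1] at h
  linarith

theorem secondForm_I_one (hP : IsConformalPatch κ f X n U r) (hw : w ∈ U) :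
    secondForm κ f X n w Complex.I 1 = 0 := by
  rw [hP.toIsSurfacePatch.secondForm_comm hP.curvature_eq hP.smooth_warping hw,
    hP.secondForm_one_I hw]

/-- `K_e = -ρ² / D`. At a parameter with `D = 0` both quotients are the junk value `0`, so that
`K_e > 0` forces `D ≠ 0` and `ρ ≠ 0`. -/
theorem extrinsicCurvature_eq (hP : IsConformalPatch κ f X n U r) (hw : w ∈ U) :
    extrinsicCurvature κ f X n w = -r w ^ 2 / coeffD κ f X w := by
  rw [extrinsicCurvature, hP.secondForm_one_one hw, hP.secondForm_I_I hw, hP.secondForm_one_I hw,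
    firstForm_comm κ f X w Complex.I 1, coeffD_eq, ← pow_two (firstForm κ f X w 1 Complex.I),
    neg_div, neg_div, div_neg, neg_neg, div_div_eq_mul_div]
  ring

theorem coeffD_ne_zero (hP : IsConformalPatch κ f X n U r) (hw : w ∈ U) : coeffD κ f X w ≠ 0 := by
  intro h
  have := hP.extrinsicCurvature_pos w hw
  rw [hP.extrinsicCurvature_eq hw, h, div_zero] at this
  exact this.false

theorem ne_zero (hP : IsConformalPatch κ f X n U r) (hw : w ∈ U) : r w ≠ 0 := by
  intro h
  have := hP.extrinsicCurvature_pos w hw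
  rw [hP.extrinsicCurvature_eq hw, h] at this
  simp at this

theorem det_ne_zero (hP : IsConformalPatch κ f X n U r) (hw : w ∈ U) :
    firstForm κ f X w 1 1 * firstForm κ f X w Complex.I Complex.I
      - firstForm κ f X w 1 Complex.I ^ 2 ≠ 0 := by
  intro h
  apply hP.coeffD_ne_zero hw
  rw [coeffD_eq, h]; simp

/-! ### Differentiability of the functions attached to the surface -/

theorem differentiableAt_rho (hP : IsConformalPatch κ f X n U r) (hw : w ∈ U) :
    DifferentiableAt ℝ r w := by
  refine ((hP.toIsSurfacePatch.differentiableAt_secondForm hP.smooth_warping hw 1 1).const_mul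
    (1 / 2)).congr_of_eventuallyEq ((hP.eventually_mem hw).mono fun w' h => ?_)
  simp only [hP.secondForm_one_one h]; ring

theorem differentiableAt_coeffE (hP : IsConformalPatch κ f X n U r) (hw : w ∈ U) :
    DifferentiableAt ℝ (coeffE κ f X) w := by
  have h := fun a b => hP.toIsSurfacePatch.differentiableAt_firstForm hP.smooth_warping hw a b
  have h1 := differentiableAt_ofReal ((h 1 1).sub (h Complex.I Complex.I))
  have h2 := (differentiableAt_ofReal (h 1 Complex.I)).const_mul (2 * Complex.I)
  exact (h1.fun_sub h2).mul_const (4 : ℂ)⁻¹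

theorem differentiableAt_coeffF (hP : IsConformalPatch κ f X n U r) (hw : w ∈ U) :
    DifferentiableAt ℝ (coeffF κ f X) w := by
  have h := fun a b => hP.toIsSurfacePatch.differentiableAt_firstForm hP.smooth_warping hw a b
  exact ((h 1 1).fun_add (h Complex.I Complex.I)).mul_const (4 : ℝ)⁻¹

theorem differentiableAt_coeffD (hP : IsConformalPatch κ f X n U r) (hw : w ∈ U) :
    DifferentiableAt ℝ (coeffD κ f X) w := by
  have h := fun a b => hP.toIsSurfacePatch.differentiableAt_firstForm hP.smooth_warping hw a b
  have h' := ((((h 1 1).fun_mul (h Complex.I Complex.I)).fun_sub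
    ((h 1 Complex.I).fun_pow 2)).fun_neg).mul_const (4 : ℝ)⁻¹
  exact h'.congr_of_eventuallyEq (Filter.Eventually.of_forall fun w' => coeffD_eq ..)

theorem differentiableAt_curvature (hP : IsConformalPatch κ f X n U r) (hw : w ∈ U) :
    DifferentiableAt ℝ (extrinsicCurvature κ f X n) w := by
  have h := (((hP.differentiableAt_rho hw).fun_pow 2).fun_neg).fun_mul
    ((hP.differentiableAt_coeffD hw).fun_inv (hP.coeffD_ne_zero hw))
  exact h.congr_of_eventuallyEq
    ((hP.eventually_mem hw).mono fun w' h => hP.extrinsicCurvature_eq h)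

theorem differentiableAt_height (hP : IsConformalPatch κ f X n U r) (hw : w ∈ U) :
    DifferentiableAt ℝ (height X) w :=
  (hasFDerivAt_components (hP.differentiableAt hw)).1.differentiableAt

theorem differentiableAt_angle (hP : IsConformalPatch κ f X n U r) (hw : w ∈ U) :
    DifferentiableAt ℝ (angle κ f X n) w :=
  (hP.hasFDerivAt_angle hw).differentiableAt

/-! ### Second derivatives of the height and first derivatives of the metric -/

theorem dz_height_eventuallyEq (hP : IsConformalPatch κ f X n U r) (hw : w ∈ U) :
    dz (fun w' => (height X w' : ℂ)) =ᶠ[nhds w] fun w' => (1 / 2) *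
      ((fderiv ℝ (height X) w' 1 : ℂ) - Complex.I * (fderiv ℝ (height X) w' Complex.I : ℂ)) :=
  (hP.eventually_mem hw).mono fun w' h => by
    dsimp only
    rw [dz_ofReal (hP.differentiableAt_height h)]; ring

theorem differentiableAt_fderiv_height (hP : IsConformalPatch κ f X n U r) (hw : w ∈ U) (u : ℂ) :
    DifferentiableAt ℝ (fun w' => fderiv ℝ (height X) w' u) w :=
  (hP.hasFDerivAt_fderiv_height hw u).differentiableAt

theorem differentiableAt_dz_height (hP : IsConformalPatch κ f X n U r) (hw : w ∈ U) :
    DifferentiableAt ℝ (dz (fun w' => (height X w' : ℂ))) w := by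
  have h := fun u => differentiableAt_ofReal (hP.differentiableAt_fderiv_height hw u)
  exact (((h 1).fun_sub
    ((h Complex.I).const_mul Complex.I)).const_mul (1 / 2)).congr_of_eventuallyEq
    (hP.dz_height_eventuallyEq hw)

theorem differentiableAt_dzbar_height (hP : IsConformalPatch κ f X n U r) (hw : w ∈ U) :
    DifferentiableAt ℝ (dzbar (fun w' => (height X w' : ℂ))) w :=
  (differentiableAt_conj (hP.differentiableAt_dz_height hw)).congr_of_eventuallyEq
    ((hP.eventually_mem hw).mono fun _ h =>
      (conj_dz_ofReal (hP.differentiableAt_height h)).symm)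

theorem fderiv_fderiv_height_comm (hP : IsConformalPatch κ f X n U r) (hw : w ∈ U) (a b : ℂ) :
    fderiv ℝ (fun w' => fderiv ℝ (height X) w' a) w b
      = fderiv ℝ (fun w' => fderiv ℝ (height X) w' b) w a := by
  rw [hP.toIsSurfacePatch.fderiv_fderiv_height hw, hP.toIsSurfacePatch.fderiv_fderiv_height hw,
    hP.coordDeriv_comm hw, firstForm_comm]
  ring

theorem dz_dz_height (hP : IsConformalPatch κ f X n U r) (hw : w ∈ U) :
    dz (dz (fun w' => (height X w' : ℂ))) w =
      ((fderiv ℝ (fun w' => fderiv ℝ (height X) w' 1) w 1 : ℂ)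
        - (fderiv ℝ (fun w' => fderiv ℝ (height X) w' Complex.I) w Complex.I : ℂ)
        - 2 * Complex.I * (fderiv ℝ (fun w' => fderiv ℝ (height X) w' 1) w Complex.I : ℂ)) / 4 := by
  have h := fun u => hP.differentiableAt_fderiv_height hw u
  have h' := fun u => differentiableAt_ofReal (h u)
  rw [dz_congr (hP.dz_height_eventuallyEq hw), dz_const_mul _ ((h' 1).fun_sub ((h' _).const_mul _)),
    dz_sub (h' 1) ((h' _).const_mul _), dz_const_mul _ (h' _), dz_ofReal (h _), dz_ofReal (h _),
    hP.fderiv_fderiv_height_comm hw Complex.I 1]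
  linear_combination (1 / 4) *
    (fderiv ℝ (fun w' => fderiv ℝ (height X) w' Complex.I) w Complex.I : ℂ) * Complex.I_sq

theorem dzbar_dz_height (hP : IsConformalPatch κ f X n U r) (hw : w ∈ U) :
    dzbar (dz (fun w' => (height X w' : ℂ))) w =
      ((fderiv ℝ (fun w' => fderiv ℝ (height X) w' 1) w 1 : ℂ)
        + (fderiv ℝ (fun w' => fderiv ℝ (height X) w' Complex.I) w Complex.I : ℂ)) / 4 := by
  have h := fun u => hP.differentiableAt_fderiv_height hw u
  have h' := fun u => differentiableAt_ofReal (h u)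
  rw [dzbar_congr (hP.dz_height_eventuallyEq hw),
    dzbar_const_mul _ ((h' 1).fun_sub ((h' _).const_mul _)),
    dzbar_sub (h' 1) ((h' _).const_mul _), dzbar_const_mul _ (h' _), dzbar_ofReal (h _),
    dzbar_ofReal (h _), hP.fderiv_fderiv_height_comm hw Complex.I 1]
  linear_combination (-1 / 4) *
    (fderiv ℝ (fun w' => fderiv ℝ (height X) w' Complex.I) w Complex.I : ℂ) * Complex.I_sq

theorem dz_dzbar_height (hP : IsConformalPatch κ f X n U r) (hw : w ∈ U) :
    dz (dzbar (fun w' => (height X w' : ℂ))) w = dzbar (dz (fun w' => (height X w' : ℂ))) w := by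
  have h : dzbar (fun w' => (height X w' : ℂ)) =ᶠ[nhds w]
      fun w' => conj (dz (fun w' => (height X w' : ℂ)) w') :=
    (hP.eventually_mem hw).mono fun w' h => (conj_dz_ofReal (hP.differentiableAt_height h)).symm
  rw [dz_congr h, dz_conj (hP.differentiableAt_dz_height hw), hP.dzbar_dz_height hw]
  simp only [map_div₀, map_add, Complex.conj_ofReal, map_ofNat]

theorem dz_coeffE (hP : IsConformalPatch κ f X n U r) (hw : w ∈ U) :
    dz (coeffE κ f X) w =
      (dz (fun w' => (firstForm κ f X w' 1 1 : ℂ)) w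
        - dz (fun w' => (firstForm κ f X w' Complex.I Complex.I : ℂ)) w
        - 2 * Complex.I * dz (fun w' => (firstForm κ f X w' 1 Complex.I : ℂ)) w) / 4 := by
  have h := fun a b => differentiableAt_ofReal
    (hP.toIsSurfacePatch.differentiableAt_firstForm hP.smooth_warping hw a b)
  have e : coeffE κ f X = fun w' => (1 / 4) * ((firstForm κ f X w' 1 1 : ℂ)
      - (firstForm κ f X w' Complex.I Complex.I : ℂ)
      - 2 * Complex.I * (firstForm κ f X w' 1 Complex.I : ℂ)) := by
    ext w'; simp only [coeffE]; push_cast; ring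
  rw [e, dz_const_mul _ (((h 1 1).fun_sub (h _ _)).fun_sub ((h _ _).const_mul _)),
    dz_sub ((h 1 1).fun_sub (h _ _)) ((h _ _).const_mul _), dz_sub (h 1 1) (h _ _),
    dz_const_mul _ (h _ _)]
  ring

theorem dzbar_coeffE (hP : IsConformalPatch κ f X n U r) (hw : w ∈ U) :
    dzbar (coeffE κ f X) w =
      (dzbar (fun w' => (firstForm κ f X w' 1 1 : ℂ)) w
        - dzbar (fun w' => (firstForm κ f X w' Complex.I Complex.I : ℂ)) w
        - 2 * Complex.I * dzbar (fun w' => (firstForm κ f X w' 1 Complex.I : ℂ)) w) / 4 := by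
  have h := fun a b => differentiableAt_ofReal
    (hP.toIsSurfacePatch.differentiableAt_firstForm hP.smooth_warping hw a b)
  have e : coeffE κ f X = fun w' => (1 / 4) * ((firstForm κ f X w' 1 1 : ℂ)
      - (firstForm κ f X w' Complex.I Complex.I : ℂ)
      - 2 * Complex.I * (firstForm κ f X w' 1 Complex.I : ℂ)) := by
    ext w'; simp only [coeffE]; push_cast; ring
  rw [e, dzbar_const_mul _ (((h 1 1).fun_sub (h _ _)).fun_sub ((h _ _).const_mul _)),
    dzbar_sub ((h 1 1).fun_sub (h _ _)) ((h _ _).const_mul _), dzbar_sub (h 1 1) (h _ _),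
    dzbar_const_mul _ (h _ _)]
  ring

theorem fderiv_coeffF (hP : IsConformalPatch κ f X n U r) (hw : w ∈ U) (u : ℂ) :
    fderiv ℝ (coeffF κ f X) w u =
      (fderiv ℝ (fun w' => firstForm κ f X w' 1 1) w u
        + fderiv ℝ (fun w' => firstForm κ f X w' Complex.I Complex.I) w u) / 4 := by
  have h := fun a b => (hP.toIsSurfacePatch.differentiableAt_firstForm hP.smooth_warping hw a b)
  have e : coeffF κ f X = fun w' => (1 / 4) * (firstForm κ f X w' 1 1
      + firstForm κ f X w' Complex.I Complex.I) := by
    ext w'; simp only [coeffF]; ring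
  rw [e, fderiv_const_mul ((h 1 1).fun_add (h _ _)), fderiv_fun_add (h _ _) (h _ _)]
  simp only [smul_apply, add_apply, smul_eq_mul]
  ring

end IsConformalPatch

/-- The Christoffel symbols of the first kind, `⟨∇̄_b X_a, X_c⟩`, in real coordinates. -/
def firstChristoffel (κ : ℝ) (f : ℝ → ℝ) (X : ℂ → Ambient) (a b c w : ℂ) : ℝ :=
  warpedMetric κ f (X w) (coordDeriv κ f X a b w) (fderiv ℝ X w c)

namespace IsConformalPatch

variable {κ : ℝ} {f : ℝ → ℝ} {X n : ℂ → Ambient} {U : Set ℂ} {r : ℂ → ℝ} {w : ℂ}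

theorem fderiv_firstForm (hP : IsConformalPatch κ f X n U r) (hw : w ∈ U) (a b c : ℂ) :
    fderiv ℝ (fun w' => firstForm κ f X w' a b) w c =
      firstChristoffel κ f X a c b w + firstChristoffel κ f X b c a w := by
  rw [hP.toIsSurfacePatch.fderiv_firstForm hP.curvature_eq hP.smooth_warping hw,
    warpedMetric_comm κ f (X w) (fderiv ℝ X w a)]
  rfl

theorem firstChristoffel_comm (hP : IsConformalPatch κ f X n U r) (hw : w ∈ U) (c : ℂ) :
    firstChristoffel κ f X Complex.I 1 c w = firstChristoffel κ f X 1 Complex.I c w := by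
  simp only [firstChristoffel, hP.coordDeriv_comm hw Complex.I 1]

/-! ### The structure equations, expanded along the frame -/

/-- The expansion of `⟨∇̄_b X_a, ∂_t⟩` along the frame. -/
theorem det_mul_hessian (hP : IsConformalPatch κ f X n U r) (hw : w ∈ U) (a b : ℂ) :
    (firstForm κ f X w 1 1 * firstForm κ f X w Complex.I Complex.I
      - firstForm κ f X w 1 Complex.I ^ 2)
        * (fderiv ℝ (fun w' => fderiv ℝ (height X) w' a) w b
          - deriv f (height X w) * (firstForm κ f X w a b
            - fderiv ℝ (height X) w a * fderiv ℝ (height X) w b)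
          - secondForm κ f X n w a b * angle κ f X n w) =
      firstForm κ f X w Complex.I Complex.I
          * (firstChristoffel κ f X a b 1 w * fderiv ℝ (height X) w 1)
        - firstForm κ f X w 1 Complex.I
          * (firstChristoffel κ f X a b 1 w * fderiv ℝ (height X) w Complex.I
            + firstChristoffel κ f X a b Complex.I w * fderiv ℝ (height X) w 1)
        + firstForm κ f X w 1 1
          * (firstChristoffel κ f X a b Complex.I w * fderiv ℝ (height X) w Complex.I) := by
  have h := hP.toIsSurfacePatch.det_mul_warpedMetric hP.curvature_eq hw (hP.det_ne_zero hw)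
    (hP.coordDeriv_mem hP.curvature_eq hw a b) (W := xi)
  rw [hP.warpedMetric_coordDeriv_normal hP.curvature_eq hP.smooth_warping hw,
    warpedMetric_comm κ f (X w) _ xi] at h
  simp only [warpedMetric_xi, ← hP.fderiv_height hw] at h
  rw [hP.toIsSurfacePatch.fderiv_fderiv_height hw, IsSurfacePatch.angle_eq]
  simp only [firstChristoffel]
  linear_combination h

/-- The expansion of `⟨∇̄_a n, ∂_t⟩` along the frame. -/
theorem det_mul_fderiv_angle (hP : IsConformalPatch κ f X n U r) (hw : w ∈ U) (a : ℂ) :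
    (firstForm κ f X w 1 1 * firstForm κ f X w Complex.I Complex.I
      - firstForm κ f X w 1 Complex.I ^ 2)
        * (fderiv ℝ (angle κ f X n) w a
          + deriv f (height X w) * (fderiv ℝ (height X) w a * angle κ f X n w)) =
      -(firstForm κ f X w Complex.I Complex.I
          * (secondForm κ f X n w 1 a * fderiv ℝ (height X) w 1)
        - firstForm κ f X w 1 Complex.I
          * (secondForm κ f X n w 1 a * fderiv ℝ (height X) w Complex.I
            + secondForm κ f X n w Complex.I a * fderiv ℝ (height X) w 1)
        + firstForm κ f X w 1 1
          * (secondForm κ f X n w Complex.I a * fderiv ℝ (height X) w Complex.I)) := by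
  have h := hP.toIsSurfacePatch.det_mul_warpedMetric hP.curvature_eq hw (hP.det_ne_zero hw)
    (hP.covDeriv_mem hP.curvature_eq hw (hP.differentiableAt_normal hw) hP.normal_tangent a)
    (W := xi)
  rw [hP.covDeriv_normal_normal hP.curvature_eq hP.smooth_warping hw,
    warpedMetric_comm κ f (X w) _ xi] at h
  simp only [warpedMetric_xi, ← hP.fderiv_height hw] at h
  rw [hP.toIsSurfacePatch.fderiv_angle hw]
  simp only [secondForm, warpedMetric_comm κ f (X w) (fderiv ℝ X w _)]
  linear_combination h

/-- The expansion of `⟨∂_t, ∂_t⟩ = 1` along the frame. -/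
theorem det_mul_one_sub_angle_sq (hP : IsConformalPatch κ f X n U r) (hw : w ∈ U) :
    (firstForm κ f X w 1 1 * firstForm κ f X w Complex.I Complex.I
      - firstForm κ f X w 1 Complex.I ^ 2) * (1 - angle κ f X n w ^ 2) =
      firstForm κ f X w Complex.I Complex.I * fderiv ℝ (height X) w 1 ^ 2
        - 2 * firstForm κ f X w 1 Complex.I
          * (fderiv ℝ (height X) w 1 * fderiv ℝ (height X) w Complex.I)
        + firstForm κ f X w 1 1 * fderiv ℝ (height X) w Complex.I ^ 2 := by
  have h := hP.toIsSurfacePatch.det_mul_warpedMetric hP.curvature_eq hw (hP.det_ne_zero hw)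
    (xi_mem κ (X w)) (W := xi)
  have h1 : xi.1 = 1 := rfl
  simp only [warpedMetric_xi, ← hP.fderiv_height hw, h1] at h
  rw [IsSurfacePatch.angle_eq]
  linear_combination h

/-- The Codazzi equation in the direction `a`, with the products `⟨∇̄_b X_a, ∇̄_c n⟩` expanded along
the frame. -/
theorem det_mul_codazzi (hP : IsConformalPatch κ f X n U r) (hw : w ∈ U) (a : ℂ) :
    (firstForm κ f X w 1 1 * firstForm κ f X w Complex.I Complex.I
      - firstForm κ f X w 1 Complex.I ^ 2)
        * (fderiv ℝ (fun w' => secondForm κ f X n w' a 1) w Complex.I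
          - fderiv ℝ (fun w' => secondForm κ f X n w' a Complex.I) w 1
          + (deriv (deriv f) (height X w) + κ * Real.exp (-2 * f (height X w))) * angle κ f X n w
          * (fderiv ℝ (height X) w Complex.I * firstForm κ f X w a 1
            - fderiv ℝ (height X) w 1 * firstForm κ f X w a Complex.I)) =
      2 * r w * (firstForm κ f X w Complex.I Complex.I * firstChristoffel κ f X a Complex.I 1 w
        - firstForm κ f X w 1 Complex.I * firstChristoffel κ f X a Complex.I Complex.I w
        + firstForm κ f X w 1 Complex.I * firstChristoffel κ f X a 1 1 w
        - firstForm κ f X w 1 1 * firstChristoffel κ f X a 1 Complex.I w) := by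
  have h := fun b c => hP.toIsSurfacePatch.det_mul_warpedMetric hP.curvature_eq hw
    (hP.det_ne_zero hw) (hP.coordDeriv_mem hP.curvature_eq hw a b) (W := covDeriv κ f X n w c)
  have hs : ∀ d c, warpedMetric κ f (X w) (covDeriv κ f X n w c) (fderiv ℝ X w d)
      = -secondForm κ f X n w d c := by
    intro d c
    rw [warpedMetric_comm]; simp only [secondForm, neg_neg]
  simp only [hP.covDeriv_normal_normal hP.curvature_eq hP.smooth_warping hw, hs, mul_zero,
    sub_zero] at h
  have h1 := h 1 Complex.I
  have h2 := h Complex.I 1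
  rw [hP.secondForm_one_I hw, hP.secondForm_I_I hw] at h1
  rw [hP.secondForm_I_one hw, hP.secondForm_one_one hw] at h2
  rw [hP.toIsSurfacePatch.codazzi hP.curvature_eq hP.smooth_warping hw]
  simp only [firstChristoffel]
  linear_combination h1 - h2

theorem fderiv_secondForm_one_one (hP : IsConformalPatch κ f X n U r) (hw : w ∈ U) :
    fderiv ℝ (fun w' => secondForm κ f X n w' 1 1) w = (2 : ℝ) • fderiv ℝ r w := by
  rw [← fderiv_const_mul (hP.differentiableAt_rho hw)]
  exact Filter.EventuallyEq.fderiv_eq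
    ((hP.eventually_mem hw).mono fun w' h => hP.secondForm_one_one h)

theorem fderiv_secondForm_I_I (hP : IsConformalPatch κ f X n U r) (hw : w ∈ U) :
    fderiv ℝ (fun w' => secondForm κ f X n w' Complex.I Complex.I) w = (2 : ℝ) • fderiv ℝ r w := by
  rw [← fderiv_const_mul (hP.differentiableAt_rho hw)]
  exact Filter.EventuallyEq.fderiv_eq ((hP.eventually_mem hw).mono fun w' h => hP.secondForm_I_I h)

theorem fderiv_secondForm_one_I (hP : IsConformalPatch κ f X n U r) (hw : w ∈ U) :
    fderiv ℝ (fun w' => secondForm κ f X n w' 1 Complex.I) w = 0 :=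
  (Filter.EventuallyEq.fderiv_eq (f := fun _ => 0)
    ((hP.eventually_mem hw).mono fun w' h => hP.secondForm_one_I h)).trans (by simp)

theorem fderiv_secondForm_I_one (hP : IsConformalPatch κ f X n U r) (hw : w ∈ U) :
    fderiv ℝ (fun w' => secondForm κ f X n w' Complex.I 1) w = 0 :=
  (Filter.EventuallyEq.fderiv_eq (f := fun _ => 0)
    ((hP.eventually_mem hw).mono fun w' h => hP.secondForm_I_one h)).trans (by simp)

/-! ### Derivatives of the metric coefficients by Christoffel symbols of the first kind -/

theorem dz_coeffE_eq (hP : IsConformalPatch κ f X n U r) (hw : w ∈ U) :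
    dz (coeffE κ f X) w = ((firstChristoffel κ f X 1 1 1 w
        - firstChristoffel κ f X Complex.I Complex.I 1 w
        - 2 * firstChristoffel κ f X 1 Complex.I Complex.I w : ℝ)
      + Complex.I * (firstChristoffel κ f X Complex.I Complex.I Complex.I w
        - firstChristoffel κ f X 1 1 Complex.I w
        - 2 * firstChristoffel κ f X 1 Complex.I 1 w : ℝ)) / 4 := by
  have h := fun a b => hP.toIsSurfacePatch.differentiableAt_firstForm hP.smooth_warping hw a b
  rw [hP.dz_coeffE hw, dz_ofReal (h _ _), dz_ofReal (h _ _), dz_ofReal (h _ _)]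
  simp only [hP.fderiv_firstForm hw, hP.firstChristoffel_comm hw]
  push_cast
  ring_nf
  simp only [Complex.I_sq]
  ring

theorem dzbar_coeffE_eq (hP : IsConformalPatch κ f X n U r) (hw : w ∈ U) :
    dzbar (coeffE κ f X) w = ((firstChristoffel κ f X 1 1 1 w
        + firstChristoffel κ f X Complex.I Complex.I 1 w : ℝ)
      - Complex.I * (firstChristoffel κ f X Complex.I Complex.I Complex.I w
        + firstChristoffel κ f X 1 1 Complex.I w : ℝ)) / 4 := by
  have h := fun a b => hP.toIsSurfacePatch.differentiableAt_firstForm hP.smooth_warping hw a b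
  rw [hP.dzbar_coeffE hw, dzbar_ofReal (h _ _), dzbar_ofReal (h _ _), dzbar_ofReal (h _ _)]
  simp only [hP.fderiv_firstForm hw, hP.firstChristoffel_comm hw]
  push_cast
  ring_nf
  simp only [Complex.I_sq]
  ring

theorem dz_coeffF_eq (hP : IsConformalPatch κ f X n U r) (hw : w ∈ U) :
    dz (fun w' => (coeffF κ f X w' : ℂ)) w = ((firstChristoffel κ f X 1 1 1 w
        + firstChristoffel κ f X 1 Complex.I Complex.I w : ℝ)
      - Complex.I * (firstChristoffel κ f X 1 Complex.I 1 w
        + firstChristoffel κ f X Complex.I Complex.I Complex.I w : ℝ)) / 4 := by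
  rw [dz_ofReal (hP.differentiableAt_coeffF hw)]
  simp only [hP.fderiv_coeffF hw, hP.fderiv_firstForm hw, hP.firstChristoffel_comm hw]
  push_cast
  ring

theorem dzbar_coeffF_eq (hP : IsConformalPatch κ f X n U r) (hw : w ∈ U) :
    dzbar (fun w' => (coeffF κ f X w' : ℂ)) w = ((firstChristoffel κ f X 1 1 1 w
        + firstChristoffel κ f X 1 Complex.I Complex.I w : ℝ)
      + Complex.I * (firstChristoffel κ f X 1 Complex.I 1 w
        + firstChristoffel κ f X Complex.I Complex.I Complex.I w : ℝ)) / 4 := by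
  rw [← conj_dz_ofReal (hP.differentiableAt_coeffF hw), hP.dz_coeffF_eq hw]
  simp only [map_div₀, map_sub, map_mul, Complex.conj_ofReal, Complex.conj_I, map_ofNat]
  ring

/-! ### The structure equations in the frame `∂_z, ∂_z̄` -/

theorem alpha_eq (hP : IsConformalPatch κ f X n U r) (hw : w ∈ U) :
    alpha κ f X w = ((firstForm κ f X w 1 1 * (-Complex.I * fderiv ℝ (height X) w Complex.I)
      - firstForm κ f X w Complex.I Complex.I * fderiv ℝ (height X) w 1
      + firstForm κ f X w 1 Complex.I * (Complex.I * fderiv ℝ (height X) w 1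
        + fderiv ℝ (height X) w Complex.I)) / 4 : ℂ) := by
  have hh := hP.differentiableAt_height hw
  rw [alpha, dz_ofReal hh, dzbar_ofReal hh, conj_coeffE, coeffF]
  push_cast
  ring_nf
  simp only [Complex.I_sq]
  ring

theorem conj_alpha_eq (hP : IsConformalPatch κ f X n U r) (hw : w ∈ U) :
    conj (alpha κ f X w) = ((firstForm κ f X w 1 1 * (Complex.I * fderiv ℝ (height X) w Complex.I)
      - firstForm κ f X w Complex.I Complex.I * fderiv ℝ (height X) w 1
      + firstForm κ f X w 1 Complex.I * (-Complex.I * fderiv ℝ (height X) w 1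
        + fderiv ℝ (height X) w Complex.I)) / 4 : ℂ) := by
  rw [hP.alpha_eq hw]
  simp only [map_div₀, map_add, map_sub, map_mul, map_neg, Complex.conj_ofReal, Complex.conj_I,
    map_ofNat]
  ring

/-- `⟨T, T⟩ = 1 - ν²` for the tangential part `T` of `∂_t`. -/
theorem alpha_mul_add (hP : IsConformalPatch κ f X n U r) (hw : w ∈ U) :
    alpha κ f X w * dz (fun w' => (height X w' : ℂ)) w
      + conj (alpha κ f X w) * dzbar (fun w' => (height X w' : ℂ)) w
      = coeffD κ f X w * (1 - (angle κ f X n w : ℂ) ^ 2) := by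
  have h := congrArg Complex.ofReal (hP.det_mul_one_sub_angle_sq hw)
  have hh := hP.differentiableAt_height hw
  push_cast at h
  rw [hP.conj_alpha_eq hw, hP.alpha_eq hw, dz_ofReal hh, dzbar_ofReal hh, coeffD_eq]
  push_cast
  linear_combination (norm := skip) (1 / 4) * h
  ring_nf
  simp only [Complex.I_sq]
  ring

/-- The derivative of the angle, as `D (ν_z + f' ν h_z) = -ρ ᾱ`. -/
theorem coeffD_mul_dz_angle (hP : IsConformalPatch κ f X n U r) (hw : w ∈ U) :
    (coeffD κ f X w : ℂ) * (dz (fun w' => (angle κ f X n w' : ℂ)) w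
      + deriv f (height X w) * angle κ f X n w * dz (fun w' => (height X w' : ℂ)) w)
      = - r w * conj (alpha κ f X w) := by
  have h1 := congrArg Complex.ofReal (hP.det_mul_fderiv_angle hw 1)
  have h2 := congrArg Complex.ofReal (hP.det_mul_fderiv_angle hw Complex.I)
  rw [hP.secondForm_one_one hw, hP.secondForm_I_one hw] at h1
  rw [hP.secondForm_I_I hw, hP.secondForm_one_I hw] at h2
  have hh := hP.differentiableAt_height hw
  push_cast at h1 h2
  rw [hP.conj_alpha_eq hw, dz_ofReal hh, dz_ofReal (hP.differentiableAt_angle hw), coeffD_eq]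
  push_cast
  -- `∂_z = (∂_x - i ∂_y) / 2`, and `D = -det I / 4`
  linear_combination (norm := skip) (-1 / 8) * (h1 - Complex.I * h2)
  ring_nf

/-- The component `(∂_z, ∂_z)` of the Hessian equation; `II` has no such component. -/
theorem coeffD_mul_dz_dz_height (hP : IsConformalPatch κ f X n U r) (hw : w ∈ U) :
    (coeffD κ f X w : ℂ) * (dz (dz (fun w' => (height X w' : ℂ))) w
      - deriv f (height X w) * (coeffE κ f X w - dz (fun w' => (height X w' : ℂ)) w ^ 2))
      = dz (coeffE κ f X) w / 2 * alpha κ f X w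
        + (dz (fun w' => (coeffF κ f X w' : ℂ)) w - dzbar (coeffE κ f X) w / 2)
          * conj (alpha κ f X w) := by
  have h1 := congrArg Complex.ofReal (hP.det_mul_hessian hw 1 1)
  have h2 := congrArg Complex.ofReal (hP.det_mul_hessian hw 1 Complex.I)
  have h3 := congrArg Complex.ofReal (hP.det_mul_hessian hw Complex.I Complex.I)
  rw [hP.secondForm_one_one hw] at h1
  rw [hP.secondForm_one_I hw] at h2
  rw [hP.secondForm_I_I hw] at h3
  have hh := hP.differentiableAt_height hw
  push_cast at h1 h2 h3
  rw [hP.conj_alpha_eq hw, hP.alpha_eq hw, hP.dz_dz_height hw, dz_ofReal hh, coeffD_eq,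
    hP.dz_coeffE_eq hw, hP.dz_coeffF_eq hw, hP.dzbar_coeffE_eq hw, coeffE,
    hP.fderiv_fderiv_height_comm hw 1 Complex.I]
  rw [hP.fderiv_fderiv_height_comm hw 1 Complex.I] at h2
  push_cast
  -- `∂_z ⊗ ∂_z = (1 ⊗ 1 - i ⊗ i - 2 i (1 ⊗ i)) / 4` on symmetric forms, and `D = -det I / 4`
  linear_combination (norm := skip) (-1 / 16) * (h1 - h3 - 2 * Complex.I * h2)
  ring_nf
  simp only [Complex.I_sq]
  ring

/-- The component `(∂_z, ∂_z̄)` of the Hessian equation, where `II` contributes `ρ ν`. -/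
theorem coeffD_mul_dzbar_dz_height (hP : IsConformalPatch κ f X n U r) (hw : w ∈ U) :
    (coeffD κ f X w : ℂ) * (dzbar (dz (fun w' => (height X w' : ℂ))) w
      - deriv f (height X w) * (coeffF κ f X w
        - dz (fun w' => (height X w' : ℂ)) w * dzbar (fun w' => (height X w' : ℂ)) w)
      - r w * angle κ f X n w)
      = dzbar (coeffE κ f X) w / 2 * alpha κ f X w
        + conj (dzbar (coeffE κ f X) w) / 2 * conj (alpha κ f X w) := by
  have h1 := congrArg Complex.ofReal (hP.det_mul_hessian hw 1 1)
  have h3 := congrArg Complex.ofReal (hP.det_mul_hessian hw Complex.I Complex.I)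
  rw [hP.secondForm_one_one hw] at h1
  rw [hP.secondForm_I_I hw] at h3
  have hh := hP.differentiableAt_height hw
  push_cast at h1 h3
  rw [hP.conj_alpha_eq hw, hP.alpha_eq hw, hP.dzbar_dz_height hw, dz_ofReal hh, dzbar_ofReal hh,
    coeffD_eq, hP.dzbar_coeffE_eq hw, coeffF]
  simp only [map_div₀, map_sub, map_mul, Complex.conj_ofReal, Complex.conj_I,
    map_ofNat]
  push_cast
  -- `∂_z ⊗ ∂_z̄ = (1 ⊗ 1 + i ⊗ i) / 4` on symmetric forms, and `D = -det I / 4`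
  linear_combination (norm := skip) (-1 / 16) * (h1 + h3)
  ring_nf
  simp only [Complex.I_sq]
  ring

/-- The Codazzi equation in the complex frame. -/
theorem codazzi_complex (hP : IsConformalPatch κ f X n U r) (hw : w ∈ U) :
    (coeffD κ f X w : ℂ) * dzbar (fun w' => (r w' : ℂ)) w
      + r w * ((conj (coeffE κ f X w) * dzbar (coeffE κ f X) w
          - coeffE κ f X w * conj (dz (coeffE κ f X) w)) / 2
        + coeffF κ f X w * (dzbar (fun w' => (coeffF κ f X w' : ℂ)) w
          - conj (dzbar (coeffE κ f X) w)))
      = ((deriv (deriv f) (height X w) + κ * Real.exp (-2 * f (height X w)) : ℝ) : ℂ)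
        * angle κ f X n w * (alpha κ f X w * coeffD κ f X w) := by
  have h1 := congrArg Complex.ofReal (hP.det_mul_codazzi hw 1)
  have h2 := congrArg Complex.ofReal (hP.det_mul_codazzi hw Complex.I)
  rw [hP.fderiv_secondForm_one_one hw, hP.fderiv_secondForm_one_I hw] at h1
  rw [hP.fderiv_secondForm_I_I hw, hP.fderiv_secondForm_I_one hw,
    firstForm_comm κ f X w Complex.I 1] at h2
  simp only [smul_apply, zero_apply, smul_eq_mul, hP.firstChristoffel_comm hw] at h1 h2
  push_cast at h1 h2
  rw [hP.alpha_eq hw, coeffD_eq, hP.dz_coeffE_eq hw, hP.dzbar_coeffF_eq hw, hP.dzbar_coeffE_eq hw,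
    dzbar_ofReal (hP.differentiableAt_rho hw), conj_coeffE, coeffE, coeffF]
  simp only [map_div₀, map_sub, map_add, map_mul, Complex.conj_ofReal, Complex.conj_I,
    map_ofNat]
  push_cast
  linear_combination (norm := skip) (1 / 16) * (h2 - Complex.I * h1)
  ring_nf
  simp only [Complex.I_sq]
  ring

/-! ### Christoffel symbols of the complex frame -/

/-- The equations `∑ k, g_{lk} Γ^k_{ij} = Γ_{ij,l}` in the complex frame, for `(i, j)` running
through `(1, 1)`, `(1, 2)`, `(2, 2)` and `l` through `1`, `2`. -/
theorem christoffel_relations (hP : IsConformalPatch κ f X n U r) (hw : w ∈ U) :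
    (coeffE κ f X w * christoffel κ f X 0 0 0 w + coeffF κ f X w * christoffel κ f X 1 0 0 w
        = dz (coeffE κ f X) w / 2) ∧
    (coeffF κ f X w * christoffel κ f X 0 0 0 w
        + conj (coeffE κ f X w) * christoffel κ f X 1 0 0 w
        = dz (fun w' => (coeffF κ f X w' : ℂ)) w - dzbar (coeffE κ f X) w / 2) ∧
    (coeffE κ f X w * christoffel κ f X 0 0 1 w + coeffF κ f X w * christoffel κ f X 1 0 1 w
        = dzbar (coeffE κ f X) w / 2) ∧
    (coeffF κ f X w * christoffel κ f X 0 0 1 w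
        + conj (coeffE κ f X w) * christoffel κ f X 1 0 1 w
        = conj (dzbar (coeffE κ f X) w) / 2) ∧
    (coeffE κ f X w * christoffel κ f X 0 1 1 w + coeffF κ f X w * christoffel κ f X 1 1 1 w
        = dzbar (fun w' => (coeffF κ f X w' : ℂ)) w - conj (dzbar (coeffE κ f X) w) / 2) ∧
    (coeffF κ f X w * christoffel κ f X 0 1 1 w
        + conj (coeffE κ f X w) * christoffel κ f X 1 1 1 w
        = conj (dz (coeffE κ f X) w) / 2) := by
  have h := christoffel_lower (Complex.ofReal_ne_zero.2 (hP.coeffD_ne_zero hw))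
  have h000 := h 0 0 0
  have h001 := h 0 0 1
  have h010 := h 0 1 0
  have h011 := h 0 1 1
  have h110 := h 1 1 0
  have h111 := h 1 1 1
  have e1 := dz_conj (hP.differentiableAt_coeffE hw)
  have e2 := dzbar_conj (hP.differentiableAt_coeffE hw)
  have eta : (fun w' => coeffE κ f X w') = coeffE κ f X := rfl
  simp only [Fin.sum_univ_two, metricMatrix, frameDeriv, Matrix.of_apply, Matrix.cons_val_zero,
    Matrix.cons_val_one, Matrix.cons_val', Matrix.cons_val_fin_one, if_true, one_ne_zero, if_false,
    e1, e2, eta] at h000 h001 h010 h011 h110 h111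
  refine ⟨?_, ?_, ?_, ?_, ?_, ?_⟩
  · linear_combination h000
  · linear_combination h001
  · linear_combination h010
  · linear_combination h011
  · linear_combination h110
  · linear_combination h111

theorem dz_coeffD (hP : IsConformalPatch κ f X n U r) (hw : w ∈ U) :
    dz (fun w' => (coeffD κ f X w' : ℂ)) w = dz (coeffE κ f X) w * conj (coeffE κ f X w)
      + coeffE κ f X w * conj (dzbar (coeffE κ f X) w)
      - 2 * coeffF κ f X w * dz (fun w' => (coeffF κ f X w' : ℂ)) w := by
  have hE := hP.differentiableAt_coeffE hw
  have hF := differentiableAt_ofReal (hP.differentiableAt_coeffF hw)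
  have e : (fun w' => (coeffD κ f X w' : ℂ)) = fun w' => coeffE κ f X w' * conj (coeffE κ f X w')
      - (coeffF κ f X w' : ℂ) * (coeffF κ f X w' : ℂ) := by
    ext w'; rw [coeffD_eq_mul, pow_two]
  rw [e, dz_sub (hE.fun_mul (differentiableAt_conj hE)) (hF.fun_mul hF), dz_mul hF hF,
    dz_mul hE (differentiableAt_conj hE), dz_conj hE]
  ring

theorem curvature_mul_coeffD (hP : IsConformalPatch κ f X n U r) (hw : w ∈ U) :
    extrinsicCurvature κ f X n w * coeffD κ f X w = -r w ^ 2 := by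
  rw [hP.extrinsicCurvature_eq hw, div_mul_cancel₀ _ (hP.coeffD_ne_zero hw)]

/-- The logarithmic derivative of `K_e D = -ρ²`. -/
theorem dzbar_coeffD_div (hP : IsConformalPatch κ f X n U r) (hw : w ∈ U) :
    dzbar (fun w' => (coeffD κ f X w' : ℂ)) w / (2 * coeffD κ f X w)
      = dzbar (fun w' => (r w' : ℂ)) w / r w
        - dzbar (fun w' => (extrinsicCurvature κ f X n w' : ℂ)) w
          / (2 * extrinsicCurvature κ f X n w) := by
  have hD := differentiableAt_ofReal (hP.differentiableAt_coeffD hw)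
  have hK := differentiableAt_ofReal (hP.differentiableAt_curvature hw)
  have hr := differentiableAt_ofReal (hP.differentiableAt_rho hw)
  have e : (fun w' => (extrinsicCurvature κ f X n w' : ℂ) * (coeffD κ f X w' : ℂ)) =ᶠ[nhds w]
      fun w' => (-1) * ((r w' : ℂ) * (r w' : ℂ)) :=
    (hP.eventually_mem hw).mono fun w' h => by
      have := congrArg Complex.ofReal (hP.curvature_mul_coeffD h)
      push_cast at this
      dsimp only
      rw [this]; ring
  have h := dzbar_congr e
  rw [dzbar_mul hK hD, dzbar_const_mul _ (hr.fun_mul hr), dzbar_mul hr hr] at h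
  have h2 := congrArg Complex.ofReal (hP.curvature_mul_coeffD hw)
  have hD0 := Complex.ofReal_ne_zero.2 (hP.coeffD_ne_zero hw)
  have hK0 := Complex.ofReal_ne_zero.2 (hP.extrinsicCurvature_pos w hw).ne'
  have hr0 := Complex.ofReal_ne_zero.2 (hP.ne_zero hw)
  push_cast at h2
  rw [div_eq_iff (by simpa using hD0)]
  field_simp
  linear_combination r w * h - 2 * dzbar (fun w' => (r w' : ℂ)) w * h2

/-- The Codazzi equation in a parameter conformal for the second fundamental form. -/
theorem codazzi_christoffel (hP : IsConformalPatch κ f X n U r) (hw : w ∈ U) :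
    dzbar (fun w' => (r w' : ℂ)) w
      + r w * (christoffel κ f X 0 0 1 w - christoffel κ f X 1 1 1 w)
      = ((deriv (deriv f) (height X w) + κ * Real.exp (-2 * f (height X w)) : ℝ) : ℂ)
        * angle κ f X n w * alpha κ f X w := by
  obtain ⟨-, -, l3, l4, l5, l6⟩ := hP.christoffel_relations hw
  refine mul_left_cancel₀ (Complex.ofReal_ne_zero.2 (hP.coeffD_ne_zero hw)) ?_
  have hD := coeffD_eq_mul κ f X w
  linear_combination hP.codazzi_complex hw
    + r w * (conj (coeffE κ f X w) * l3 - coeffF κ f X w * l4)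
    - r w * (coeffE κ f X w * l6 - coeffF κ f X w * l5)
    + r w * (christoffel κ f X 0 0 1 w - christoffel κ f X 1 1 1 w) * hD

theorem dzbar_coeffD (hP : IsConformalPatch κ f X n U r) (hw : w ∈ U) :
    dzbar (fun w' => (coeffD κ f X w' : ℂ)) w = conj (dz (coeffE κ f X) w) * coeffE κ f X w
      + conj (coeffE κ f X w) * dzbar (coeffE κ f X) w
      - 2 * coeffF κ f X w * dzbar (fun w' => (coeffF κ f X w' : ℂ)) w := by
  rw [← conj_dz_ofReal (hP.differentiableAt_coeffD hw), hP.dz_coeffD hw,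
    ← conj_dz_ofReal (hP.differentiableAt_coeffF hw)]
  simp only [map_add, map_sub, map_mul, Complex.conj_conj, Complex.conj_ofReal, map_ofNat]

/-- The trace identity `∑ k, Γ^k_{k2} = ∂_2 D / (2 D)`. -/
theorem christoffel_trace_dzbar (hP : IsConformalPatch κ f X n U r) (hw : w ∈ U) :
    christoffel κ f X 0 0 1 w + christoffel κ f X 1 1 1 w
      = dzbar (fun w' => (coeffD κ f X w' : ℂ)) w / (2 * coeffD κ f X w) := by
  obtain ⟨-, -, l3, l4, l5, l6⟩ := hP.christoffel_relations hw
  have hD := coeffD_eq_mul κ f X w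
  have hD0 := Complex.ofReal_ne_zero.2 (hP.coeffD_ne_zero hw)
  rw [eq_div_iff (by simpa using hD0), hP.dzbar_coeffD hw]
  linear_combination 2 * (conj (coeffE κ f X w) * l3 - coeffF κ f X w * l4)
    + 2 * (coeffE κ f X w * l6 - coeffF κ f X w * l5)
    + 2 * (christoffel κ f X 0 0 1 w + christoffel κ f X 1 1 1 w) * hD

/-- The trace identity `∑ k, Γ^k_{k1} = ∂_1 D / (2 D)`. -/
theorem christoffel_trace_dz (hP : IsConformalPatch κ f X n U r) (hw : w ∈ U) :
    christoffel κ f X 0 0 0 w + christoffel κ f X 1 0 1 w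
      = dz (fun w' => (coeffD κ f X w' : ℂ)) w / (2 * coeffD κ f X w) := by
  obtain ⟨l1, l2, l3, l4, -, -⟩ := hP.christoffel_relations hw
  have hD := coeffD_eq_mul κ f X w
  have hD0 := Complex.ofReal_ne_zero.2 (hP.coeffD_ne_zero hw)
  rw [eq_div_iff (by simpa using hD0), hP.dz_coeffD hw]
  linear_combination 2 * (conj (coeffE κ f X w) * l1 - coeffF κ f X w * l2)
    + 2 * (coeffE κ f X w * l4 - coeffF κ f X w * l3)
    + 2 * (christoffel κ f X 0 0 0 w + christoffel κ f X 1 0 1 w) * hD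

/-- `Γ^2_{12}` is the conjugate of `Γ^1_{12}`, because the first fundamental form is real. -/
theorem conj_christoffel (hP : IsConformalPatch κ f X n U r) (hw : w ∈ U) :
    conj (christoffel κ f X 0 0 1 w) = christoffel κ f X 1 0 1 w := by
  obtain ⟨-, -, l3, l4, -, -⟩ := hP.christoffel_relations hw
  have hD := coeffD_eq_mul κ f X w
  have l3' := congrArg conj l3
  have l4' := congrArg conj l4
  simp only [map_add, map_mul, map_div₀, Complex.conj_conj, Complex.conj_ofReal, map_ofNat]
    at l3' l4'
  refine mul_left_cancel₀ (Complex.ofReal_ne_zero.2 (hP.coeffD_ne_zero hw)) ?_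
  linear_combination coeffE κ f X w * l3' - coeffF κ f X w * l4'
    - (coeffE κ f X w * l4 - coeffF κ f X w * l3)
    + (conj (christoffel κ f X 0 0 1 w) - christoffel κ f X 1 0 1 w) * hD

/-- The symbol `Γ^1_{12}`, from its difference with `Γ^2_{22}` (Codazzi) and its sum with it
(trace). -/
theorem christoffel_zero_zero_one (hP : IsConformalPatch κ f X n U r) (hw : w ∈ U) :
    christoffel κ f X 0 0 1 w
      = -(dzbar (fun w' => (extrinsicCurvature κ f X n w' : ℂ)) w
          / (4 * extrinsicCurvature κ f X n w))
        + angle κ f X n w * alpha κ f X w / (2 * r w)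
          * ((deriv (deriv f) (height X w) + κ * Real.exp (-2 * f (height X w)) : ℝ) : ℂ) := by
  have h1 := hP.codazzi_christoffel hw
  have h2 := hP.christoffel_trace_dzbar hw
  rw [hP.dzbar_coeffD_div hw] at h2
  have hK0 := Complex.ofReal_ne_zero.2 (hP.extrinsicCurvature_pos w hw).ne'
  have hr0 := Complex.ofReal_ne_zero.2 (hP.ne_zero hw)
  have h3 : christoffel κ f X 1 1 1 w = dzbar (fun w' => (r w' : ℂ)) w / r w
        - dzbar (fun w' => (extrinsicCurvature κ f X n w' : ℂ)) w
          / (2 * extrinsicCurvature κ f X n w) - christoffel κ f X 0 0 1 w := by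
    linear_combination h2
  rw [h3] at h1
  generalize ((deriv (deriv f) (height X w) + κ * Real.exp (-2 * f (height X w)) : ℝ) : ℂ) = c
    at h1 ⊢
  field_simp at h1 ⊢
  linear_combination 2 * h1

/-- The symbol `Γ^2_{12}`. -/
theorem christoffel_one_zero_one (hP : IsConformalPatch κ f X n U r) (hw : w ∈ U) :
    christoffel κ f X 1 0 1 w
      = -(dz (fun w' => (extrinsicCurvature κ f X n w' : ℂ)) w
          / (4 * extrinsicCurvature κ f X n w))
        + angle κ f X n w * conj (alpha κ f X w) / (2 * r w)
          * ((deriv (deriv f) (height X w) + κ * Real.exp (-2 * f (height X w)) : ℝ) : ℂ) := by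
  rw [← hP.conj_christoffel hw, hP.christoffel_zero_zero_one hw,
    ← conj_dz_ofReal (hP.differentiableAt_curvature hw)]
  simp only [map_add, map_neg, map_mul, map_div₀, Complex.conj_conj, Complex.conj_ofReal,
    map_ofNat]

/-! ### Derivatives of the angle, the height and `α` -/

/-- `ν_z = -II(∂_z, T) - f' ν h_z`, where `K_e D = -ρ²` turns the component `ᾱ / D` of `T` into
`-ᾱ K_e / ρ²`. -/
theorem dz_angle (hP : IsConformalPatch κ f X n U r) (hw : w ∈ U) :
    dz (fun w' => (angle κ f X n w' : ℂ)) w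
      = conj (alpha κ f X w) * extrinsicCurvature κ f X n w / r w
        - deriv f (height X w) * angle κ f X n w * dz (fun w' => (height X w' : ℂ)) w := by
  have h1 := hP.coeffD_mul_dz_angle hw
  have h2 := congrArg Complex.ofReal (hP.curvature_mul_coeffD hw)
  have hD0 := Complex.ofReal_ne_zero.2 (hP.coeffD_ne_zero hw)
  have hr0 := Complex.ofReal_ne_zero.2 (hP.ne_zero hw)
  push_cast at h2
  rw [eq_sub_iff_add_eq, eq_div_iff hr0]
  refine mul_left_cancel₀ hD0 ?_
  linear_combination r w * h1 - conj (alpha κ f X w) * h2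

theorem dz_dz_height_eq (hP : IsConformalPatch κ f X n U r) (hw : w ∈ U) :
    dz (dz (fun w' => (height X w' : ℂ))) w
      = christoffel κ f X 0 0 0 w * dz (fun w' => (height X w' : ℂ)) w
        + christoffel κ f X 1 0 0 w * dzbar (fun w' => (height X w' : ℂ)) w
        + deriv f (height X w) * coeffE κ f X w
        - deriv f (height X w) * dz (fun w' => (height X w' : ℂ)) w ^ 2 := by
  obtain ⟨l1, l2, -, -, -, -⟩ := hP.christoffel_relations hw
  have hD := coeffD_eq_mul κ f X w
  refine mul_left_cancel₀ (Complex.ofReal_ne_zero.2 (hP.coeffD_ne_zero hw)) ?_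
  have h := hP.coeffD_mul_dz_dz_height hw
  rw [← l1, ← l2] at h
  have ha : alpha κ f X w = conj (coeffE κ f X w) * dz (fun w' => (height X w' : ℂ)) w
    - (coeffF κ f X w : ℂ) * dzbar (fun w' => (height X w' : ℂ)) w := rfl
  have ha' := congrArg conj ha
  rw [← conj_dz_ofReal (hP.differentiableAt_height hw)] at ha ha' ⊢
  simp only [map_sub, map_mul, Complex.conj_conj, Complex.conj_ofReal] at ha'
  rw [ha', ha] at h
  linear_combination h - (christoffel κ f X 0 0 0 w * dz (fun w' => (height X w' : ℂ)) w
        + christoffel κ f X 1 0 0 w * conj (dz (fun w' => (height X w' : ℂ)) w)) * hD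

/-- The mixed second derivative of the height in terms of the Christoffel symbols. -/
theorem dzbar_dz_height_christoffel (hP : IsConformalPatch κ f X n U r) (hw : w ∈ U) :
    dzbar (dz (fun w' => (height X w' : ℂ))) w
      = christoffel κ f X 0 0 1 w * dz (fun w' => (height X w' : ℂ)) w
        + christoffel κ f X 1 0 1 w * dzbar (fun w' => (height X w' : ℂ)) w
        + r w * angle κ f X n w
        + deriv f (height X w) * (coeffF κ f X w
          - dzbar (fun w' => (height X w' : ℂ)) w * dz (fun w' => (height X w' : ℂ)) w) := by
  obtain ⟨-, -, l3, l4, -, -⟩ := hP.christoffel_relations hw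
  have hD := coeffD_eq_mul κ f X w
  refine mul_left_cancel₀ (Complex.ofReal_ne_zero.2 (hP.coeffD_ne_zero hw)) ?_
  have h := hP.coeffD_mul_dzbar_dz_height hw
  rw [← l3, ← l4] at h
  have ha : alpha κ f X w = conj (coeffE κ f X w) * dz (fun w' => (height X w' : ℂ)) w
    - (coeffF κ f X w : ℂ) * dzbar (fun w' => (height X w' : ℂ)) w := rfl
  have ha' := congrArg conj ha
  rw [← conj_dz_ofReal (hP.differentiableAt_height hw)] at ha ha' h ⊢
  simp only [map_sub, map_mul, Complex.conj_conj, Complex.conj_ofReal] at ha'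
  rw [ha', ha] at h
  linear_combination h - (christoffel κ f X 0 0 1 w * dz (fun w' => (height X w' : ℂ)) w
        + christoffel κ f X 1 0 1 w * conj (dz (fun w' => (height X w' : ℂ)) w)) * hD

theorem dzbar_dz_height_eq (hP : IsConformalPatch κ f X n U r) (hw : w ∈ U) :
    dzbar (dz (fun w' => (height X w' : ℂ))) w
      = r w * angle κ f X n w
          * (1 - ((deriv (deriv f) (height X w) + κ * Real.exp (-2 * f (height X w)) : ℝ) : ℂ)
            * (1 - (angle κ f X n w : ℂ) ^ 2) / (2 * extrinsicCurvature κ f X n w))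
        - 1 / (4 * extrinsicCurvature κ f X n w)
          * (dzbar (fun w' => (extrinsicCurvature κ f X n w' : ℂ)) w
              * dz (fun w' => (height X w' : ℂ)) w
            + dz (fun w' => (extrinsicCurvature κ f X n w' : ℂ)) w
              * dzbar (fun w' => (height X w' : ℂ)) w)
        + deriv f (height X w) * (coeffF κ f X w
          - dzbar (fun w' => (height X w' : ℂ)) w * dz (fun w' => (height X w' : ℂ)) w) := by
  rw [hP.dzbar_dz_height_christoffel hw, hP.christoffel_zero_zero_one hw,
    hP.christoffel_one_zero_one hw]
  have h1 := hP.alpha_mul_add hw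
  have h2 := congrArg Complex.ofReal (hP.curvature_mul_coeffD hw)
  have hK0 := Complex.ofReal_ne_zero.2 (hP.extrinsicCurvature_pos w hw).ne'
  have hr0 := Complex.ofReal_ne_zero.2 (hP.ne_zero hw)
  push_cast at h2
  generalize ((deriv (deriv f) (height X w) + κ * Real.exp (-2 * f (height X w)) : ℝ) : ℂ) = c
  field_simp
  linear_combination 4 * c * angle κ f X n w
    * (extrinsicCurvature κ f X n w * h1 + (1 - (angle κ f X n w : ℂ) ^ 2) * h2)

theorem differentiableAt_alpha (hP : IsConformalPatch κ f X n U r) (hw : w ∈ U) :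
    DifferentiableAt ℝ (alpha κ f X) w := by
  have hh := hP.differentiableAt_dz_height hw
  have hb := hP.differentiableAt_dzbar_height hw
  exact ((differentiableAt_conj (hP.differentiableAt_coeffE hw)).fun_mul hh).fun_sub
    ((differentiableAt_ofReal (hP.differentiableAt_coeffF hw)).fun_mul hb)

/-- Differentiating `α = Ē h_z - F h_z̄` and inserting the second derivatives of `h` leaves only the
symbols `Γ^1_{11} + Γ^2_{12}`, `Γ^2_{12}` and `Γ^1_{12}`. -/
theorem dz_alpha (hP : IsConformalPatch κ f X n U r) (hw : w ∈ U) :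
    dz (alpha κ f X) w
      = alpha κ f X w
          * (dz (fun w' => (coeffD κ f X w' : ℂ)) w / (2 * coeffD κ f X w))
        + 1 / (4 * extrinsicCurvature κ f X n w)
          * (conj (alpha κ f X w) * dzbar (fun w' => (extrinsicCurvature κ f X n w' : ℂ)) w
            - alpha κ f X w * dz (fun w' => (extrinsicCurvature κ f X n w' : ℂ)) w)
        - r w * coeffF κ f X w * angle κ f X n w
        - deriv f (height X w) * (alpha κ f X w * dz (fun w' => (height X w' : ℂ)) w
          - coeffD κ f X w) := by
  have hE := hP.differentiableAt_coeffE hw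
  have hF := differentiableAt_ofReal (hP.differentiableAt_coeffF hw)
  have hh := hP.differentiableAt_dz_height hw
  have hb := hP.differentiableAt_dzbar_height hw
  have e : alpha κ f X = fun w' => conj (coeffE κ f X w') * dz (fun w' => (height X w' : ℂ)) w'
    - (coeffF κ f X w' : ℂ) * dzbar (fun w' => (height X w' : ℂ)) w' := rfl
  have h := congrArg (fun g => dz g w) e
  beta_reduce at h
  rw [dz_sub ((differentiableAt_conj hE).fun_mul hh) (hF.fun_mul hb),
    dz_mul (differentiableAt_conj hE) hh, dz_mul hF hb, dz_conj hE, hP.dz_dzbar_height hw,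
    hP.dz_dz_height_eq hw, hP.dzbar_dz_height_christoffel hw] at h
  obtain ⟨l1, l2, l3, l4, -, -⟩ := hP.christoffel_relations hw
  have ha : alpha κ f X w = conj (coeffE κ f X w) * dz (fun w' => (height X w' : ℂ)) w
    - (coeffF κ f X w : ℂ) * dzbar (fun w' => (height X w' : ℂ)) w := rfl
  have ha' := congrArg conj ha
  simp only [map_sub, map_mul, Complex.conj_conj, Complex.conj_ofReal,
    ← conj_dz_ofReal (hP.differentiableAt_height hw)] at ha' ha h ⊢
  have hD := coeffD_eq_mul κ f X w
  -- the derivative of `α` in terms of the Christoffel symbols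
  have key : dz (alpha κ f X) w = alpha κ f X w
        * (christoffel κ f X 0 0 0 w + christoffel κ f X 1 0 1 w)
      + alpha κ f X w * christoffel κ f X 1 0 1 w
      - conj (alpha κ f X w) * christoffel κ f X 0 0 1 w
      - r w * coeffF κ f X w * angle κ f X n w
      - deriv f (height X w) * (alpha κ f X w * dz (fun w' => (height X w' : ℂ)) w
          - coeffD κ f X w) := by
    rw [ha', ha, hD]
    linear_combination h - 2 * dz (fun w' => (height X w' : ℂ)) w * l4
      + conj (dz (fun w' => (height X w' : ℂ)) w) * (l2 + l3)
  rw [key, hP.christoffel_trace_dz hw, hP.christoffel_zero_zero_one hw,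
    hP.christoffel_one_zero_one hw]
  have hD0 := Complex.ofReal_ne_zero.2 (hP.coeffD_ne_zero hw)
  have hK0 := Complex.ofReal_ne_zero.2 (hP.extrinsicCurvature_pos w hw).ne'
  have hr0 := Complex.ofReal_ne_zero.2 (hP.ne_zero hw)
  field_simp
  ring

theorem hasFDerivAt_deriv_warping (hP : IsConformalPatch κ f X n U r) (hw : w ∈ U) :
    HasFDerivAt (fun w' => deriv f (height X w'))
      (deriv (deriv f) (height X w) • fderiv ℝ (height X) w) w :=
  HasDerivAt.comp_hasFDerivAt w
    ((contDiff_infty_iff_deriv.1 hP.smooth_warping).2.differentiable (by simp) _).hasDerivAt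
    (hP.differentiableAt_height hw).hasFDerivAt

theorem dzbar_inv_rho (hP : IsConformalPatch κ f X n U r) (hw : w ∈ U) :
    DifferentiableAt ℝ (fun w' => ((r w' : ℂ))⁻¹) w ∧
    dzbar (fun w' => ((r w' : ℂ))⁻¹) w = -dzbar (fun w' => (r w' : ℂ)) w / r w ^ 2 := by
  have hr := differentiableAt_ofReal (hP.differentiableAt_rho hw)
  have hr0 := Complex.ofReal_ne_zero.2 (hP.ne_zero hw)
  have hi := hr.fun_inv hr0
  refine ⟨hi, ?_⟩
  have e : (fun w' => (r w' : ℂ) * ((r w' : ℂ))⁻¹) =ᶠ[nhds w] fun _ => 1 :=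
    (hP.eventually_mem hw).mono fun w' h =>
      mul_inv_cancel₀ (Complex.ofReal_ne_zero.2 (hP.ne_zero h))
  have h := dzbar_congr e
  rw [dzbar_mul hr hi] at h
  have h0 : dzbar (fun _ => (1 : ℂ)) w = 0 := by simp [dzbar]
  rw [h0] at h
  rw [eq_div_iff (pow_ne_zero 2 hr0)]
  linear_combination r w * h - dzbar (fun w' => (r w' : ℂ)) w * mul_inv_cancel₀ hr0

/-- Differentiate `ν_z = ᾱ K_e / ρ - f' ν h_z`. The result is symmetric in `z, z̄`, and
`ᾱ h_z̄ K_e / ρ + ν_z̄ h_z = α h_z K_e / ρ + ν_z h_z̄` brings it to the form stated. -/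
theorem dzbar_dz_angle (hP : IsConformalPatch κ f X n U r) (hw : w ∈ U) :
    dzbar (dz (fun w' => (angle κ f X n w' : ℂ))) w
      = 1 / (4 * r w)
          * (conj (alpha κ f X w) * dzbar (fun w' => (extrinsicCurvature κ f X n w' : ℂ)) w
            + alpha κ f X w * dz (fun w' => (extrinsicCurvature κ f X n w' : ℂ)) w)
        - extrinsicCurvature κ f X n w * coeffF κ f X w * angle κ f X n w
        - extrinsicCurvature κ f X n w * deriv f (height X w) / r w
          * (alpha κ f X w * dz (fun w' => (height X w' : ℂ)) w - coeffD κ f X w)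
        - deriv f (height X w)
          * (dz (fun w' => (angle κ f X n w' : ℂ)) w * dzbar (fun w' => (height X w' : ℂ)) w
            + angle κ f X n w * dzbar (dz (fun w' => (height X w' : ℂ))) w)
        - deriv (deriv f) (height X w) * angle κ f X n w
          * (‖dz (fun w' => (height X w' : ℂ)) w‖ : ℂ) ^ 2 := by
  have hh := hP.differentiableAt_height hw
  have hz := hP.differentiableAt_dz_height hw
  have hν := differentiableAt_ofReal (hP.differentiableAt_angle hw)
  have hK := differentiableAt_ofReal (hP.differentiableAt_curvature hw)
  have ha := hP.differentiableAt_alpha hw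
  have hac := differentiableAt_conj ha
  have hf1 := hP.hasFDerivAt_deriv_warping hw
  have hf1' := differentiableAt_ofReal hf1.differentiableAt
  obtain ⟨hi, hi'⟩ := hP.dzbar_inv_rho hw
  have e : dz (fun w' => (angle κ f X n w' : ℂ)) =ᶠ[nhds w] fun w' =>
      (conj (alpha κ f X w') * (extrinsicCurvature κ f X n w' : ℂ)) * ((r w' : ℂ))⁻¹
        - ((deriv f (height X w') : ℝ) : ℂ) * (angle κ f X n w' : ℂ)
          * dz (fun w' => (height X w' : ℂ)) w' :=
    (hP.eventually_mem hw).mono fun _ h => by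
      dsimp only
      rw [hP.dz_angle h, div_eq_mul_inv]
  rw [dzbar_congr e, dzbar_sub ((hac.fun_mul hK).fun_mul hi) ((hf1'.fun_mul hν).fun_mul hz),
    dzbar_mul (hac.fun_mul hK) hi, dzbar_mul hac hK, hi', dzbar_mul (hf1'.fun_mul hν) hz,
    dzbar_mul hf1' hν, dzbar_conj ha]
  have d1 : dzbar (fun w' => ((deriv f (height X w') : ℝ) : ℂ)) w
      = deriv (deriv f) (height X w) * dzbar (fun w' => (height X w' : ℂ)) w := by
    rw [dzbar_ofReal hf1.differentiableAt, dzbar_ofReal hh, hf1.fderiv]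
    simp only [smul_apply, smul_eq_mul]
    push_cast; ring
  have d2 := congrArg conj (hP.dz_angle hw)
  have d3 := congrArg conj (hP.dz_alpha hw)
  have d4 : (‖dz (fun w' => (height X w' : ℂ)) w‖ : ℂ) ^ 2
      = dz (fun w' => (height X w' : ℂ)) w * dzbar (fun w' => (height X w' : ℂ)) w := by
    rw [← conj_dz_ofReal hh, Complex.mul_conj, Complex.normSq_eq_norm_sq]
    push_cast; rfl
  have d5 : conj (dzbar (fun w' => (extrinsicCurvature κ f X n w' : ℂ)) w)
      = dz (fun w' => (extrinsicCurvature κ f X n w' : ℂ)) w := by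
    rw [← conj_dz_ofReal (hP.differentiableAt_curvature hw), Complex.conj_conj]
  simp only [map_add, map_sub, map_mul, map_div₀, map_one, Complex.conj_conj, Complex.conj_ofReal,
    map_ofNat, conj_dz_ofReal hh, conj_dz_ofReal (hP.differentiableAt_angle hw),
    conj_dz_ofReal (hP.differentiableAt_coeffD hw),
    conj_dz_ofReal (hP.differentiableAt_curvature hw), d5] at d2 d3
  rw [d1, d2, d3, d4, hP.dz_angle hw, hP.dzbar_coeffD_div hw]
  have hK0 := Complex.ofReal_ne_zero.2 (hP.extrinsicCurvature_pos w hw).ne'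
  have hr0 := Complex.ofReal_ne_zero.2 (hP.ne_zero hw)
  generalize dzbar (dz (fun w' => (height X w' : ℂ))) w = hzz
  field_simp
  ring

end IsConformalPatch

/-! ### Local parameters of an immersed surface -/

/-- A local parameter of an immersed surface, conformal for the second fundamental form, gives a
conformal patch. -/
theorem IsConformalForSecondForm.isConformalPatch {κ : ℝ} (hκ : κ = -1 ∨ κ = 0 ∨ κ = 1)
    {f : ℝ → ℝ} (hf : ContDiff ℝ ∞ f)
    {S : Type*} [TopologicalSpace S] [ChartedSpace ℂ S] [IsManifold 𝓘(ℝ, ℂ) ∞ S]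
    {φ N : S → Ambient} (hφ : IsSurfaceImmersion κ φ) (hN : IsUnitNormal κ f φ N)
    (hK : HasPosExtrinsicCurvature κ f φ N)
    {z : OpenPartialHomeomorph S ℂ} {r : ℂ → ℝ} (hz : IsConformalForSecondForm κ f φ N z r) :
    IsConformalPatch κ f (φ ∘ z.symm) (N ∘ z.symm) z.target r := by
  have hs : ∀ w ∈ z.target, ContMDiffAt 𝓘(ℝ, ℂ) 𝓘(ℝ, ℂ) ∞ z.symm w := fun w hw =>
    contMDiffAt_symm_of_mem_maximalAtlas hz.1 hw
  refine
    { isOpen := z.open_target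
      smooth := fun w hw => ((hφ.smooth _).comp w (hs w hw)).contDiffAt
      smooth_normal := fun w hw => ((hN.smooth _).comp w (hs w hw)).contDiffAt
      mem := fun w _ => hφ.mem _
      normal_tangent := fun w _ => hN.tangent _
      unit := fun w _ => hN.unit _
      normal := fun w hw u => ?_
      curvature_eq := hκ
      smooth_warping := hf
      secondForm_self := hz.2
      extrinsicCurvature_pos := hK z hz.1 }
  have h : mfderiv 𝓘(ℝ, ℂ) 𝓘(ℝ, Ambient) (φ ∘ z.symm) w = _ :=
    mfderiv_comp w ((hφ.smooth _).mdifferentiableAt (by simp))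
      ((hs w hw).mdifferentiableAt (by simp))
  rw [mfderiv_eq_fderiv] at h
  rw [h]
  exact hN.normal _ _

end WarpedSurface

end

open WarpedSurface in
theorem lemmal2 (κ : ℝ) (hκ : κ = -1 ∨ κ = 0 ∨ κ = 1) (f : ℝ → ℝ) (hf : ContDiff ℝ ∞ f)
    {S : Type*} [TopologicalSpace S] [ChartedSpace ℂ S] [IsManifold 𝓘(ℝ, ℂ) ∞ S]
    (φ N : S → Ambient) (hφ : IsSurfaceImmersion κ φ) (hN : IsUnitNormal κ f φ N)
    (hK : HasPosExtrinsicCurvature κ f φ N)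
    (z : OpenPartialHomeomorph S ℂ) (r : ℂ → ℝ) (hz : IsConformalForSecondForm κ f φ N z r) :
    -- the surface, its unit normal and all the functions in the parameter `z`
    let X : ℂ → Ambient := φ ∘ z.symm
    let n : ℂ → Ambient := N ∘ z.symm
    let ρ : ℂ → ℂ := fun w => (r w : ℂ)
    let E : ℂ → ℂ := coeffE κ f X
    let F : ℂ → ℂ := fun w => (coeffF κ f X w : ℂ)
    let D : ℂ → ℂ := fun w => (coeffD κ f X w : ℂ)
    let α : ℂ → ℂ := alpha κ f X
    let K : ℂ → ℂ := fun w => (extrinsicCurvature κ f X n w : ℂ)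
    let h : ℂ → ℂ := fun w => (height X w : ℂ)
    let ν : ℂ → ℂ := fun w => (angle κ f X n w : ℂ)
    let Γ : Fin 2 → Fin 2 → Fin 2 → ℂ → ℂ := christoffel κ f X
    -- `f'`, `f''` and `f'' + κ e^{-2f}` along the surface
    let f₁ : ℂ → ℂ := fun w => ((deriv f (height X w) : ℝ) : ℂ)
    let f₂ : ℂ → ℂ := fun w => ((deriv (deriv f) (height X w) : ℝ) : ℂ)
    let c : ℂ → ℂ := fun w => f₂ w + ((κ * Real.exp (-2 * f (height X w)) : ℝ) : ℂ)
    ∀ w ∈ z.target,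
      dzbar ρ w / ρ w + (Γ 0 0 1 w - Γ 1 1 1 w) = ν w / ρ w * α w * c w ∧
      dz ν w = conj (α w) * K w / ρ w - f₁ w * ν w * dz h w ∧
      Γ 0 0 1 w = -(dzbar K w / (4 * K w)) + ν w * α w / (2 * ρ w) * c w ∧
      dz (dz h) w = Γ 0 0 0 w * dz h w + Γ 1 0 0 w * dzbar h w + f₁ w * E w
        - f₁ w * dz h w ^ 2 ∧
      dzbar (dz h) w = ρ w * ν w * (1 - c w * (1 - ν w ^ 2) / (2 * K w))
        - 1 / (4 * K w) * (dzbar K w * dz h w + dz K w * dzbar h w)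
        + f₁ w * (F w - dzbar h w * dz h w) ∧
      dz α w = α w * (dz D w / (2 * D w))
        + 1 / (4 * K w) * (conj (α w) * dzbar K w - α w * dz K w)
        - ρ w * F w * ν w - f₁ w * (α w * dz h w - D w) ∧
      dzbar (dz ν) w = 1 / (4 * ρ w) * (conj (α w) * dzbar K w + α w * dz K w)
        - K w * F w * ν w - K w * f₁ w / ρ w * (α w * dz h w - D w)
        - f₁ w * (dz ν w * dzbar h w + ν w * dzbar (dz h) w)
        - f₂ w * ν w * (‖dz h w‖ : ℂ) ^ 2 := by
  intro X n ρ E F D α K h ν Γ f₁ f₂ c w hw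
  have hP : IsConformalPatch κ f X n z.target r :=
    IsConformalForSecondForm.isConformalPatch hκ hf hφ hN hK hz
  have hc : c w = ((deriv (deriv f) (height X w) + κ * Real.exp (-2 * f (height X w)) : ℝ) : ℂ) :=
    (Complex.ofReal_add _ _).symm
  refine ⟨?_, hP.dz_angle hw, ?_, hP.dz_dz_height_eq hw, ?_, hP.dz_alpha hw, hP.dzbar_dz_angle hw⟩
  · have hr0 : ρ w ≠ 0 := Complex.ofReal_ne_zero.2 (hP.ne_zero hw)
    have h1 : dzbar ρ w + ρ w * (Γ 0 0 1 w - Γ 1 1 1 w) = c w * ν w * α w := by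
      rw [hc]; exact hP.codazzi_christoffel hw
    field_simp
    linear_combination h1
  · rw [hc]; exact hP.christoffel_zero_zero_one hw
  · rw [hc]; exact hP.dzbar_dz_height_eq hw
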